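/- Let $d\ge 2$ and let $T_d$ be the infinite $d$-regular tree with vertex set $V$ and a root $o$. Let $S$ be a finite set and let $Q=(Q(s,t))_{s,t\in S}$ be the transition matrix of a Markov chain on $S$ that is reversible with respect to a probability distribution $\pi$ on $S$, i.e. $\pi(s)Q(s,t)=\pi(t)Q(t,s)$ for all $s,t\in S$. The branching Markov process $\nu_Q$ is the following probability measure on $S^{V}$: the state of $o$ has distribution $\pi$; given the states of all vertices at distance at most $k$ from $o$, the states of the vertices at distance $k+1$ are conditionally independent, and the state of such a vertex has distribution $Q(s,\cdot)$, where $s$ is the state of its neighbour at distance $k$ from $o$. Fix a vertex $v$ with set of neighbours $N(v)$. For $\omega\in S^{N(v)}$ let $B_{v,\omega}$ be the conditional distribution under $\nu_Q$ of the state of $v$ given that the states on $N(v)$ are $\omega$ (if this event has probability $0$, let $B_{v,\omega}$ be an arbitrary fixed probability distribution on $S$). The Dobrushin coefficient is $$D=\sup\bigl\{d_{TV}(B_{v,\omega},B_{v,\omega'}) : \omega,\omega'\in S^{N(v)},\ |\{u\in N(v):\omega(u)\ne\omega'(u)\}|=1\bigr\},\qquad d_{TV}(P_1,P_2)=\tfrac12\sum_{s\in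 S}|P_1(s)-P_2(s)|$$ (with $\sup\emptyset=0$). If $D<1/d$, then $\nu_Q$ is a factor of i.i.d. process. That is, $\nu_Q$ is invariant under all automorphisms of $T_d$, and there is a measurable function $f:[0,1]^{V}\to S$, invariant under all automorphisms of $T_d$ that fix $o$, such that $\nu_Q$ is the distribution of the random labelling of $V$ that is obtained from independent uniform $[0,1]$ labels $x=(x_u)_{u\in V}$ by giving to each vertex $w$ the label $f(x\circ\varphi)$, where $\varphi$ is any automorphism of $T_d$ with $\varphi(o)=w$. -/

import Mathlib

open MeasureTheory

noncomputable section

namespace TreeProcess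

variable {V : Type*} (G : SimpleGraph V)

/-! ### Invariant processes and factors

A process on `G` with values in `M` is a measure on `V → M` with the product σ-algebra. For countable
`V` and a second countable space `M` with its Borel σ-algebra, this is the Borel σ-algebra. -/

/-- `I(M)`: the probability measures on `V → M` that are invariant under all automorphisms of `G`. -/
def invariantProcesses (M : Type*) [MeasurableSpace M] : Set (Measure (V → M)) :=
  {μ | IsProbabilityMeasure μ ∧ ∀ φ : G ≃g G, μ.map (fun x u => x (φ u)) = μ}

/-- `ν` is a factor of `μ`: there is a measurable rule `f`, invariant under the automorphisms that fix
the root `o`, such that `ν` is the law of the labelling obtained from a `μ`-random labelling `x` by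
evaluating `f` at every vertex. To evaluate `f` at a vertex `φ o`, where `φ` is an automorphism, one
moves the root there, i.e. one evaluates `f` at `x ∘ φ`; by the invariance of `f` the result depends
on `φ o` only. (On a regular tree every vertex is of the form `φ o`.) -/
def IsFactor {M N : Type*} [MeasurableSpace M] [MeasurableSpace N] (o : V)
    (ν : Measure (V → N)) (μ : Measure (V → M)) : Prop :=
  ∃ f : (V → M) → N, Measurable f ∧
    (∀ φ : G ≃g G, φ o = o → ∀ x : V → M, f (fun u => x (φ u)) = f x) ∧
    ∃ F : (V → M) → (V → N),
      (∀ (φ : G ≃g G) (x : V → M), F x (φ o) = f (fun u => x (φ u))) ∧ ν = μ.map F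

/-- I.i.d. labels, uniform on `[0,1]`, at the vertices. -/
def uniformLabels (V : Type*) : Measure (V → unitInterval) :=
  Measure.infinitePi fun _ : V => (volume : Measure unitInterval)

/-- `F(N)`: the invariant processes with values in `N` that are factors of the i.i.d. uniform
process. -/
def factorOfIID (N : Type*) [MeasurableSpace N] (o : V) : Set (Measure (V → N)) :=
  {ν | ν ∈ invariantProcesses G N ∧ IsFactor G o ν (uniformLabels V)}

/-! ### The branching Markov process

The transition matrix of a Markov chain on `S` is given by its rows `Q s : PMF S`, so that `Q s t` is
the probability of a step from `s` to `t`. -/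

section Branching

variable {S : Type*}

/-- Detailed balance of the transition matrix `Q` with respect to the distribution `π`. -/
def IsReversible (π : PMF S) (Q : S → PMF S) : Prop :=
  ∀ s t, π s * Q s t = π t * Q t s

variable {G} in
/-- The state at the end of a walk that starts in the state `s`, when the update to be made on
arriving at a vertex `w` is the map `ξ w : S → S`. -/
def stateAlong (ξ : V → S → S) : S → {u v : V} → G.Walk u v → S
  | s, _, _, .nil => s
  | s, _, _, .cons (v := w) _ p => stateAlong ξ (ξ w s) p

variable {G} in
/-- The labelling in which the root `o` has state `z.1` and every other vertex `w` has state
`z.2 w s`, where `s` is the state of the neighbour of `w` on the path from `o` to `w`. -/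
def propagate (hG : G.IsTree) (o : V) (z : S × (V → S → S)) (v : V) : S :=
  stateAlong z.2 z.1 (hG.existsUnique_path o v).choose

variable [MeasurableSpace S] [Fintype S]

/-- The randomness of the branching Markov process: a state of distribution `π` and, for all vertices
`w` and states `s`, a state `ξ w s` of distribution `Q s`, all independent. -/
def branchingNoise (V : Type*) (π : PMF S) (Q : S → PMF S) : Measure (S × (V → S → S)) :=
  π.toMeasure.prod (Measure.infinitePi fun _ : V => Measure.pi fun s => (Q s).toMeasure)

variable {G} in
/-- The branching Markov process on the tree `G`: the state of the root `o` has distribution `π`, and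
given the states of the vertices at distance at most `k` from `o`, the states of the vertices at
distance `k + 1` are chosen independently, each from the row of `Q` of the state of its neighbour at
distance `k`. -/
def branchingMarkov (hG : G.IsTree) (o : V) (π : PMF S) (Q : S → PMF S) : Measure (V → S) :=
  (branchingNoise V π Q).map (propagate hG o)

end Branching

/-! ### The Dobrushin coefficient -/

section Dobrushin

variable {S : Type*}

/-- Total variation distance of two distributions on a finite set. -/
def tvDist [Fintype S] (P₁ P₂ : PMF S) : ℝ :=
  1 / 2 * ∑ s, |(P₁ s).toReal - (P₂ s).toReal|

/-- `B ω` is the conditional distribution, under the process `ν`, of the state of `v` given that the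
states of the neighbours of `v` are `ω`. If this event has positive probability, then `B ω` is
determined by `ν`; otherwise it may be any distribution on `S`. -/
def IsConditionalLaw [MeasurableSpace S] (ν : Measure (V → S)) (v : V)
    (B : (G.neighborSet v → S) → PMF S) : Prop :=
  ∀ (ω : G.neighborSet v → S) (s : S),
    ν {x | x v = s ∧ ∀ u : G.neighborSet v, x u = ω u} =
      ν {x | ∀ u : G.neighborSet v, x u = ω u} * B ω s

variable {G} in
/-- The Dobrushin coefficient: the supremum of the distance of `B ω` and `B ω'` over all `ω`, `ω'`
that differ at exactly one neighbour of `v`. -/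
def dobrushinCoeff [Fintype S] {v : V} (B : (G.neighborSet v → S) → PMF S) : ℝ :=
  sSup {r | ∃ ω ω' : G.neighborSet v → S, (∃! u, ω u ≠ ω' u) ∧ r = tvDist (B ω) (B ω')}

end Dobrushin

end TreeProcess

end

/-!
The branching Markov process `ν` is a Markov random field on the tree: given all other vertices, the
state of a vertex depends on its neighbours only. This follows from reversibility, which makes the
law of the process independent of the root (`branchingMarkov_root`), so that one may place the root
at the vertex in question (`branchingMarkov_markov`). Root independence also gives the invariance
under automorphisms.

Consider the heat bath dynamics in which, at each step, every vertex tosses a fair coin, and the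
vertices with outcome `true` all of whose neighbours have outcome `false` resample their states from
their conditional distributions. The resampled vertices form an independent set, so `ν` is
stationary (`evolve_eq_self`). If two labellings evolve with the same coins and with maximally
coupled updates, then, because each of the `d` neighbours influences an update by at most `D` and
`d * D < 1`, the probability that they disagree at a given vertex decays exponentially
(`prod_step_ne_le`). Hence the dynamics converges to `ν` from any starting point
(`tendsto_evolve_iterate`).

To realize `ν` as a factor, run the dynamics from time `-n` to time `0`, for all `n` at once and
from the same constant labelling. A single random update map cannot in general be maximally coupled for
all pairs of environments, but a sequence of runs only needs its consecutive members to be maximally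
coupled, and this can be achieved: sample the states of the runs at an updated vertex one after the
other, each from its conditional distribution given the preceding one (`coupledSeq`). The runs
`n` and `n + 1` then disagree at time `0` at a given vertex with exponentially small probability, so
by the Borel–Cantelli lemma the states at time `0` are eventually constant in `n`. Their limit
(`fromPast`) is an equivariant function of the randomness and has law `ν` (`map_fromPast`).

The local rule `B` is given at one vertex only, and it is arbitrary on environments of probability
zero. Averaging over the bijections of neighbourhoods (`averagedRule`) carries it over to all
vertices in an equivariant way without increasing the Dobrushin coefficient.
-/

noncomputable section

open scoped ENNReal

namespace TreeProcess

/-! ### Product measures -/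

section ProductMeasures

/-- Finite measures on `V → S` with `S` finite are determined by the probabilities of the events
that prescribe the states of finitely many vertices. -/
lemma ext_of_cylinders {V S : Type*} [Finite S] [Nonempty S] [MeasurableSpace S]
    [DiscreteMeasurableSpace S] {μ ν : Measure (V → S)} [IsFiniteMeasure ν]
    (h : ∀ (A : Finset V) (σ : V → S),
      μ {x | ∀ a ∈ A, x a = σ a} = ν {x | ∀ a ∈ A, x a = σ a}) : μ = ν := by
  classical
  refine IsProjectiveLimit.unique (P := fun I : Finset V => ν.map I.restrict) ?_ fun I => rfl
  intro I
  refine Measure.ext_of_singleton fun (τ : I → S) => ?_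
  rw [Measure.map_apply (by fun_prop) (by measurability),
    Measure.map_apply (by fun_prop) (by measurability)]
  have : I.restrict ⁻¹' ({τ} : Set (I → S)) =
      {x : V → S | ∀ a ∈ I, x a = if ha : a ∈ I then τ ⟨a, ha⟩ else Classical.arbitrary S} := by
    ext x
    simp only [Set.mem_preimage, Set.mem_singleton_iff, Set.mem_ofPred_eq, funext_iff]
    constructor
    · intro hx a ha
      simpa [ha] using hx ⟨a, ha⟩
    · rintro hx ⟨a, ha⟩
      simpa [ha] using hx a ha
  rw [this]
  exact h I _

lemma measurableSet_eq_const {α S : Type*} [MeasurableSpace α] [MeasurableSpace S]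
    [MeasurableSingletonClass S] {f : α → S} (hf : Measurable f) (s : S) :
    MeasurableSet {x | f x = s} := hf (measurableSet_singleton s)

lemma measurableSet_cylinder {V S : Type*} [MeasurableSpace S] [MeasurableSingletonClass S]
    (A : Finset V) (σ : V → S) : MeasurableSet {x : V → S | ∀ a ∈ A, x a = σ a} := by
  have : {x : V → S | ∀ a ∈ A, x a = σ a} = Set.pi A fun a => {σ a} := by
    ext x; simp [Set.mem_pi]
  rw [this]
  exact MeasurableSet.pi A.countable_toSet fun a _ => measurableSet_singleton _

lemma measurableSet_eq_and_cylinder {V S : Type*} [MeasurableSpace S] [MeasurableSingletonClass S]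
    (w : V) (s : S) (A : Finset V) (σ : V → S) :
    MeasurableSet {x : V → S | x w = s ∧ ∀ a ∈ A, x a = σ a} :=
  (measurableSet_eq_const (f := fun x : V → S => x w) (measurable_pi_apply w) s).inter
    (measurableSet_cylinder A σ)

lemma infinitePi_cylinder_eq {V : Type*} {S : Type*} [MeasurableSpace S]
    [MeasurableSingletonClass S] (μ : V → Measure S) [∀ v, IsProbabilityMeasure (μ v)]
    (A : Finset V) (σ : V → S) :
    Measure.infinitePi μ {x | ∀ a ∈ A, x a = σ a} = ∏ a ∈ A, μ a {σ a} := by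
  rw [← Measure.infinitePi_pi μ fun a _ => measurableSet_singleton (σ a)]
  congr 1

/-- An event that does not depend on the coordinates in `F` is independent of the coordinates
in `F`. -/
lemma infinitePi_pi_inter {ι : Type*} {X : ι → Type*} [∀ i, MeasurableSpace (X i)]
    (μ : ∀ i, Measure (X i)) [∀ i, IsProbabilityMeasure (μ i)] (F : Finset ι)
    {t : ∀ i, Set (X i)} (ht : ∀ i, MeasurableSet (t i)) {E : Set (∀ i, X i)}
    (hE : MeasurableSet E) (hF : ∀ x y : ∀ i, X i, (∀ i, i ∉ F → x i = y i) → x ∈ E → y ∈ E) :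
    Measure.infinitePi μ (Set.pi F t ∩ E)
      = (∏ i ∈ F, μ i (t i)) * Measure.infinitePi μ E := by
  classical
  have : ∀ i, Nonempty (X i) := fun i => nonempty_of_isProbabilityMeasure (μ i)
  set m : ι → MeasurableSpace (∀ i, X i) := fun i =>
    MeasurableSpace.comap (fun x : ∀ i, X i => x i) inferInstance with hm
  have hle : ∀ i, m i ≤ MeasurableSpace.pi := fun i =>
    (measurable_pi_apply (X := X) i).comap_le
  have hind : ProbabilityTheory.iIndep m (Measure.infinitePi μ) :=
    ProbabilityTheory.iIndepFun_infinitePi (P := μ) (X := fun i (x : X i) => x)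
      fun i => measurable_id
  have key := ProbabilityTheory.indep_iSup_of_disjoint hle hind
    (S := (F : Set ι)) (T := (F : Set ι)ᶜ) disjoint_compl_right
  rw [ProbabilityTheory.Indep_iff] at key
  rw [key, Measure.infinitePi_pi μ fun i _ => ht i]
  · rw [Set.pi_def]
    refine @MeasurableSet.biInter _ _ (_) _ _ F.countable_toSet fun i hi => ?_
    exact (le_iSup₂ (f := fun i (_ : i ∈ (F : Set ι)) => m i) i hi) _ ⟨_, ht i, rfl⟩
  · -- `E` is its own preimage under the map that overwrites the coordinates in `F`
    let x₀ : ∀ i, X i := fun i => Classical.arbitrary _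
    let g : (∀ i, X i) → ∀ i, X i := fun x i => if i ∈ F then x₀ i else x i
    have hg : Measurable[⨆ i ∈ (F : Set ι)ᶜ, m i] g := by
      refine (@measurable_pi_iff _ _ X (⨆ i ∈ (F : Set ι)ᶜ, m i) (fun _ => inferInstance) g).2
        fun i => ?_
      by_cases hi : i ∈ F
      · simp only [g, hi, if_true]
        exact @measurable_const _ _ _ (_) _
      · simp only [g, hi, if_false]
        intro s hs
        exact (le_iSup₂ (f := fun i (_ : i ∈ (F : Set ι)ᶜ) => m i) i (by simpa using hi)) _
          ⟨s, hs, rfl⟩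
    have : E = g ⁻¹' E := by
      ext x
      constructor
      · exact hF _ _ fun i hi => by simp [g, hi]
      · exact hF _ _ fun i hi => by simp [g, hi]
    rw [this]
    exact hg hE

/-- Independent families of pairs of independent variables can be sampled one component at a
time. -/
lemma map_zip_infinitePi {V S T : Type*} [Finite S] [Finite T] [MeasurableSpace S]
    [DiscreteMeasurableSpace S] [MeasurableSpace T] [DiscreteMeasurableSpace T]
    (μ : V → Measure S) (ν : V → Measure T)
    [∀ v, IsProbabilityMeasure (μ v)] [∀ v, IsProbabilityMeasure (ν v)]
    [Nonempty S] [Nonempty T] :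
    ((Measure.infinitePi μ).prod (Measure.infinitePi ν)).map (fun p v => (p.1 v, p.2 v)) =
      Measure.infinitePi fun v => (μ v).prod (ν v) := by
  refine ext_of_cylinders fun A σ => ?_
  rw [infinitePi_cylinder_eq, Measure.map_apply (by fun_prop) (measurableSet_cylinder A σ)]
  have : (fun (p : (V → S) × (V → T)) v => (p.1 v, p.2 v)) ⁻¹' {x | ∀ a ∈ A, x a = σ a} =
      {x | ∀ a ∈ A, x a = (σ a).1} ×ˢ {x | ∀ a ∈ A, x a = (σ a).2} := by
    ext p
    simp only [Set.mem_preimage, Set.mem_ofPred_eq, Set.mem_prod, Prod.ext_iff]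
    exact forall₂_and
  rw [this, Measure.prod_prod, infinitePi_cylinder_eq _ A fun a => (σ a).1,
    infinitePi_cylinder_eq _ A fun a => (σ a).2, ← Finset.prod_mul_distrib]
  refine Finset.prod_congr rfl fun a _ => ?_
  rw [← Measure.prod_prod, Set.singleton_prod_singleton]

/-- The product over `ι` of products over `κ` is the product over `κ` of products over `ι`. -/
lemma map_swap_infinitePi {ι κ X : Type*} [MeasurableSpace X] (μ : Measure X)
    [IsProbabilityMeasure μ] :
    (Measure.infinitePi fun _ : ι => Measure.infinitePi fun _ : κ => μ).map (fun x k i => x i k) =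
      Measure.infinitePi fun _ : κ => Measure.infinitePi fun _ : ι => μ := by
  rw [← Measure.infinitePi_map_curry fun (_ : ι) (_ : κ) => μ,
    ← Measure.infinitePi_map_curry fun (_ : κ) (_ : ι) => μ,
    Measure.map_map (by fun_prop) (by fun_prop),
    ← Measure.infinitePi_map_piCongrLeft (fun _ : κ × ι => μ) (Equiv.prodComm ι κ),
    Measure.map_map (by fun_prop) (by fun_prop)]
  congr 1

lemma measurable_cons {X : Type*} [MeasurableSpace X] : Measurable fun (p : X × (ℕ → X)) (n : ℕ) =>
    Nat.casesOn (motive := fun _ => X) n p.1 p.2 := by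
  refine measurable_pi_iff.2 fun n => ?_
  cases n
  · exact measurable_fst
  · exact (measurable_pi_apply _).comp measurable_snd

/-- An i.i.d. sequence is an independent pair of its first member and an i.i.d. sequence. -/
lemma map_cons_infinitePi {X : Type*} [MeasurableSpace X] (μ : Measure X)
    [IsProbabilityMeasure μ] :
    (μ.prod (Measure.infinitePi fun _ : ℕ => μ)).map
        (fun p n => Nat.casesOn (motive := fun _ => X) n p.1 p.2) =
      Measure.infinitePi fun _ : ℕ => μ := by
  refine Measure.eq_infinitePi _ fun s t ht => ?_
  -- extend the box trivially, so that it prescribes an initial segment of coordinates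
  set t' : ℕ → Set X := fun i => if i ∈ s then t i else Set.univ with ht'
  have hm' : ∀ i, MeasurableSet (t' i) := fun i => by
    by_cases hi : i ∈ s <;> simp [ht', hi, ht]
  obtain ⟨N, hN⟩ : ∃ N, s ⊆ Finset.range (N + 1) :=
    ⟨s.sup id, fun i hi => Finset.mem_range.2 (Nat.lt_succ_of_le (Finset.le_sup (f := id) hi))⟩
  have h1 : Set.pi (s : Set ℕ) t = Set.pi (Finset.range (N + 1) : Set ℕ) t' := by
    ext x
    simp only [Set.mem_pi, Finset.mem_coe]
    constructor
    · intro h i _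
      by_cases hi : i ∈ s
      · simpa [ht', hi] using h i hi
      · simp [ht', hi]
    · intro h i hi
      simpa [ht', hi] using h i (hN hi)
  have h2 : ∏ i ∈ s, μ (t i) = ∏ i ∈ Finset.range (N + 1), μ (t' i) := by
    rw [← Finset.prod_subset hN]
    · exact Finset.prod_congr rfl fun i hi => by simp [ht', hi]
    · intro i _ hi
      simp [ht', hi]
  have h3 : (fun (p : X × (ℕ → X)) (n : ℕ) => Nat.casesOn (motive := fun _ => X) n p.1 p.2) ⁻¹'
      Set.pi (Finset.range (N + 1) : Set ℕ) t' =
        t' 0 ×ˢ Set.pi (Finset.range N : Set ℕ) fun i => t' (i + 1) := by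
    ext p
    simp only [Set.mem_preimage, Set.mem_pi, Finset.mem_coe, Finset.mem_range, Set.mem_prod]
    constructor
    · exact fun h => ⟨h 0 (by lia), fun i hi => h (i + 1) (by lia)⟩
    · rintro ⟨h0, h⟩ (_ | i) hi
      · exact h0
      · exact h i (by lia)
  rw [h1, h2, Measure.map_apply measurable_cons (MeasurableSet.pi (Finset.countable_toSet _)
    fun i _ => hm' i), h3, Measure.prod_prod, Measure.infinitePi_pi _ fun i _ => hm' (i + 1),
    Finset.prod_range_succ', mul_comm]

end ProductMeasures

/-! ### Maximal couplings -/

section Coupling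

variable {S : Type*} [Fintype S]

lemma sum_pmf_apply (p : PMF S) : ∑ s, p s = 1 := by
  rw [← tsum_fintype (L := .unconditional S), p.tsum_coe]

/-- The mass that has to be moved to turn `p` into `q`. -/
def excess (p q : PMF S) : ℝ≥0∞ := ∑ s, (p s - q s)

lemma excess_ne_top (p q : PMF S) : excess p q ≠ ∞ :=
  ENNReal.sum_ne_top.2 fun s _ => ENNReal.sub_ne_top (p.apply_ne_top s)

lemma excess_comm (p q : PMF S) : excess p q = excess q p := by
  have h (p q : PMF S) : ∑ s, min (p s) (q s) + excess p q = 1 := by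
    rw [excess, ← Finset.sum_add_distrib, ← sum_pmf_apply p]
    refine Finset.sum_congr rfl fun s _ => ?_
    rcases le_total (p s) (q s) with h | h
    · simp [h, tsub_eq_zero_of_le h]
    · rw [min_eq_right h, add_tsub_cancel_of_le h]
  have h1 := h p q
  rw [← h q p] at h1
  simp_rw [min_comm (q _)] at h1
  exact (ENNReal.add_right_inj (ENNReal.sum_ne_top.2 fun s _ =>
    ((min_le_left _ _).trans_lt (p.apply_lt_top s)).ne)).1 h1

/-- Both excesses are half of the `ℓ¹` distance. -/
lemma toReal_excess (p q : PMF S) : (excess p q).toReal = tvDist p q := by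
  have h (p q : PMF S) : (excess p q).toReal = ∑ s, max ((p s).toReal - (q s).toReal) 0 := by
    rw [excess, ENNReal.toReal_sum fun s _ => ENNReal.sub_ne_top (p.apply_ne_top s)]
    refine Finset.sum_congr rfl fun s _ => ?_
    rcases le_total (p s) (q s) with h | h
    · have := (ENNReal.toReal_le_toReal (p.apply_ne_top s) (q.apply_ne_top s)).2 h
      rw [tsub_eq_zero_of_le h, max_eq_right (by linarith), ENNReal.toReal_zero]
    · have := (ENNReal.toReal_le_toReal (q.apply_ne_top s) (p.apply_ne_top s)).2 h
      rw [ENNReal.toReal_sub_of_le h (p.apply_ne_top s), max_eq_left (by linarith)]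
  have h2 : tvDist p q = 1 / 2 * ((excess p q).toReal + (excess q p).toReal) := by
    rw [h, h, ← Finset.sum_add_distrib, tvDist]
    congr 1
    refine Finset.sum_congr rfl fun s _ => ?_
    rcases le_total (p s).toReal (q s).toReal with h | h
    · rw [max_eq_right (by linarith), max_eq_left (by linarith), abs_of_nonpos (by linarith)]
      ring
    · rw [max_eq_left (by linarith), max_eq_right (by linarith), abs_of_nonneg (by linarith)]
      ring
  rw [h2, excess_comm q p]
  ring

open Classical in
/-- The weights of the maximal coupling of `p` and `q`: the common mass `min p q` sits on the
diagonal, the rest is coupled independently. If `p = q`, the second term is `0 / 0 = 0`. -/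
def couplingWeight (p q : PMF S) (s t : S) : ℝ≥0∞ :=
  (if s = t then min (p s) (q s) else 0) + (p s - q s) * (q t - p t) / excess p q

lemma min_add_excess (p q : PMF S) (s : S) :
    min (p s) (q s) + (p s - q s) * excess p q / excess p q = p s := by
  have h0 : (p s - q s) * excess p q / excess p q = p s - q s := by
    by_cases h : excess p q = 0
    · have : p s - q s = 0 := Finset.sum_eq_zero_iff.1 h s (Finset.mem_univ s)
      simp [this]
    · exact ENNReal.mul_div_cancel_right h (excess_ne_top p q)
  rw [h0]
  rcases le_total (p s) (q s) with h | h
  · simp [h, tsub_eq_zero_of_le h]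
  · rw [min_eq_right h, add_tsub_cancel_of_le h]

lemma sum_couplingWeight_right (p q : PMF S) (s : S) : ∑ t, couplingWeight p q s t = p s := by
  simp only [couplingWeight]
  rw [Finset.sum_add_distrib, Finset.sum_eq_single s (by simp +contextual [eq_comm]) (by simp),
    if_pos rfl]
  simp only [ENNReal.div_eq_inv_mul, ← Finset.mul_sum]
  rw [← ENNReal.div_eq_inv_mul]
  change _ + (p s - q s) * excess q p / _ = _
  rw [excess_comm q p, min_add_excess]

lemma sum_couplingWeight_left (p q : PMF S) (t : S) : ∑ s, couplingWeight p q s t = q t := by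
  simp only [couplingWeight]
  rw [Finset.sum_add_distrib, Finset.sum_eq_single t (by simp +contextual) (by simp),
    if_pos rfl]
  simp only [ENNReal.div_eq_inv_mul, ← Finset.mul_sum, ← Finset.sum_mul]
  rw [← ENNReal.div_eq_inv_mul]
  change _ + excess p q * (q t - p t) / _ = _
  rw [mul_comm, excess_comm p q, min_comm, min_add_excess]

open Classical in
lemma sum_couplingWeight_ne (p q : PMF S) :
    ∑ s, ∑ t, (if s = t then 0 else couplingWeight p q s t) ≤ excess p q := by
  calc ∑ s, ∑ t, (if s = t then 0 else couplingWeight p q s t)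
      ≤ ∑ s, ∑ t, (p s - q s) * (q t - p t) / excess p q := by
        gcongr with s _ t _
        by_cases h : s = t <;> simp [h, couplingWeight]
    _ = excess p q * excess p q / excess p q := by
        simp only [ENNReal.div_eq_inv_mul, ← Finset.mul_sum, ← Finset.sum_mul]
        change _ * (excess p q * excess q p) = _
        rw [excess_comm q p]
    _ ≤ excess p q := by
        rw [mul_div_assoc]
        exact mul_le_of_le_one_right zero_le ENNReal.div_self_le_one

open Classical in
/-- The conditional distribution of the second component of the maximal coupling of `p` and `q`,
given that the first component is `s`. -/
def couplingRow (p q : PMF S) (s : S) : PMF S :=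
  if h : p s = 0 then q else
    PMF.normalize (couplingWeight p q s)
      (by rwa [tsum_fintype, sum_couplingWeight_right])
      (by rw [tsum_fintype, sum_couplingWeight_right]; exact p.apply_ne_top s)

lemma mul_couplingRow (p q : PMF S) (s t : S) :
    p s * couplingRow p q s t = couplingWeight p q s t := by
  have hsum := sum_couplingWeight_right p q s
  by_cases h : p s = 0
  · rw [h] at hsum ⊢
    rw [Finset.sum_eq_zero_iff.1 hsum t (Finset.mem_univ t), zero_mul]
  · rw [couplingRow, dif_neg h, PMF.normalize_apply, tsum_fintype, hsum, mul_comm, mul_assoc,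
      ENNReal.inv_mul_cancel h (p.apply_ne_top s), mul_one]

variable [Nonempty S] [MeasurableSpace S] [DiscreteMeasurableSpace S]

lemma exists_sample (p : PMF S) :
    ∃ f : unitInterval → S, Measurable f ∧ (volume : Measure unitInterval).map f = p.toMeasure :=
  Measure.exists_measurable_map_eq p.toMeasure

/-- A function of a uniform variable that has distribution `p`. -/
def sample (p : PMF S) : unitInterval → S := (exists_sample p).choose

lemma measurable_sample (p : PMF S) : Measurable (sample p) := (exists_sample p).choose_spec.1

lemma volume_sample (p : PMF S) (s : S) :
    (volume : Measure unitInterval) (sample p ⁻¹' {s}) = p s := by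
  have h : (volume : Measure unitInterval).map (sample p) = p.toMeasure :=
    (exists_sample p).choose_spec.2
  rw [← Measure.map_apply (measurable_sample p) (measurableSet_singleton s), h,
    PMF.toMeasure_apply_singleton _ _ (measurableSet_singleton s)]

/-- A sequence of states, driven by the uniform variables `r n`, in which the `n`-th state has
distribution `p n` and consecutive states are maximally coupled. -/
def coupledSeq (p : ℕ → PMF S) (r : ℕ → unitInterval) : ℕ → S
  | 0 => sample (p 0) (r 0)
  | n + 1 => sample (couplingRow (p n) (p (n + 1)) (coupledSeq p r n)) (r (n + 1))

/-- The law of the driving variables of `coupledSeq`. -/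
def uniformSeq : Measure (ℕ → unitInterval) :=
  Measure.infinitePi fun _ : ℕ => (volume : Measure unitInterval)

instance : IsProbabilityMeasure uniformSeq := by unfold uniformSeq; infer_instance

/-- The `n`-th member of a coupled sequence depends on the first `n + 1` distributions and
driving variables only. -/
lemma coupledSeq_congr {p p' : ℕ → PMF S} {r r' : ℕ → unitInterval} {n : ℕ}
    (hp : ∀ m ≤ n, p m = p' m) (hr : ∀ m ≤ n, r m = r' m) : coupledSeq p r n = coupledSeq p' r' n := by
  induction n with
  | zero => simp [coupledSeq, hp, hr]
  | succ n ih =>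
    simp only [coupledSeq]
    rw [ih (fun m hm => hp m (by lia)) (fun m hm => hr m (by lia)), hp n (by lia), hp _ le_rfl,
      hr _ le_rfl]

/-- `coupledSeq` is measurable, also when the distributions are random but take only finitely many
values. -/
lemma measurable_coupledSeq {α : Type*} [MeasurableSpace α] {Λ : Type*} [Countable Λ]
    [MeasurableSpace Λ] [DiscreteMeasurableSpace Λ] (b : Λ → PMF S) {l : α → ℕ → Λ}
    {r : α → ℕ → unitInterval} (hl : Measurable l) (hr : Measurable r) (n : ℕ) :
    Measurable fun x => coupledSeq (fun m => b (l x m)) (r x) n := by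
  have hl' (m : ℕ) : Measurable fun x => l x m := (measurable_pi_apply m).comp hl
  have hr' (m : ℕ) : Measurable fun x => r x m := (measurable_pi_apply m).comp hr
  induction n with
  | zero =>
    have : Measurable fun q : Λ × unitInterval => sample (b q.1) q.2 :=
      measurable_from_prod_countable_right fun x => measurable_sample (b x)
    simp only [coupledSeq]
    have h2 := this.comp ((hl' 0).prodMk (hr' 0))
    simpa only [Function.comp_def] using h2
  | succ n ih =>
    have : Measurable fun q : ((Λ × Λ) × S) × unitInterval =>
        sample (couplingRow (b q.1.1.1) (b q.1.1.2) q.1.2) q.2 :=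
      measurable_from_prod_countable_right fun x =>
        measurable_sample (couplingRow (b x.1.1) (b x.1.2) x.2)
    simp only [coupledSeq]
    have h2 := this.comp ((((hl' n).prodMk (hl' (n + 1))).prodMk ih).prodMk (hr' (n + 1)))
    simpa only [Function.comp_def] using h2

lemma measurable_coupledSeq_right (p : ℕ → PMF S) (n : ℕ) :
    Measurable fun r => coupledSeq p r n :=
  measurable_coupledSeq (Λ := ℕ) p (l := fun _ m => m) measurable_const measurable_id n

lemma uniformSeq_coupledSeq_pair (p : ℕ → PMF S) (n : ℕ) (s t : S) :
    uniformSeq {r | coupledSeq p r n = s ∧ coupledSeq p r (n + 1) = t} =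
      uniformSeq {r | coupledSeq p r n = s} * couplingRow (p n) (p (n + 1)) s t := by
  have h : {r | coupledSeq p r n = s ∧ coupledSeq p r (n + 1) = t} =
      Set.pi (({n + 1} : Finset ℕ) : Set ℕ)
        (fun _ => sample (couplingRow (p n) (p (n + 1)) s) ⁻¹' {t}) ∩
      {r | coupledSeq p r n = s} := by
    ext r
    simp only [Set.mem_ofPred_eq, Set.mem_inter_iff, Finset.coe_singleton, Set.singleton_pi,
      Set.mem_preimage, Function.eval, Set.mem_singleton_iff, coupledSeq]
    constructor
    · rintro ⟨h1, h2⟩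
      rw [h1] at h2
      exact ⟨h2, h1⟩
    · rintro ⟨h1, h2⟩
      rw [h2]
      exact ⟨rfl, h1⟩
  have hE : MeasurableSet {r | coupledSeq p r n = s} :=
    measurable_coupledSeq_right p n (measurableSet_singleton s)
  rw [h, uniformSeq, infinitePi_pi_inter _ _
    (fun _ => measurable_sample _ (measurableSet_singleton t)) hE, Finset.prod_singleton,
    volume_sample, mul_comm]
  intro x y hxy hx
  rw [Set.mem_ofPred_eq] at hx ⊢
  rw [← hx]
  exact coupledSeq_congr (fun _ _ => rfl) fun m hm => (hxy m (by simp; lia)).symm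

lemma uniformSeq_coupledSeq (p : ℕ → PMF S) (n : ℕ) (s : S) :
    uniformSeq {r | coupledSeq p r n = s} = p n s := by
  induction n generalizing s with
  | zero =>
    rw [← volume_sample,
      ← Measure.infinitePi_map_eval (fun _ : ℕ => (volume : Measure unitInterval)) 0,
      Measure.map_apply (by fun_prop) (measurable_sample _ (measurableSet_singleton s))]
    rfl
  | succ n ih =>
    have h : {r | coupledSeq p r (n + 1) = s} =
        ⋃ a, {r | coupledSeq p r n = a ∧ coupledSeq p r (n + 1) = s} := by
      ext r; simp
    rw [h, measure_iUnion, tsum_fintype]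
    · simp_rw [uniformSeq_coupledSeq_pair, ih, mul_couplingRow, sum_couplingWeight_left]
    · intro a b hab
      refine Set.disjoint_left.2 fun r h1 h2 => hab ?_
      exact h1.1.symm.trans h2.1
    · exact fun a => (measurable_coupledSeq_right p n (measurableSet_singleton a)).inter
        (measurable_coupledSeq_right p (n + 1) (measurableSet_singleton s))

lemma map_coupledSeq (p : ℕ → PMF S) (n : ℕ) :
    uniformSeq.map (fun r => coupledSeq p r n) = (p n).toMeasure := by
  refine Measure.ext_of_singleton fun s => ?_
  rw [Measure.map_apply (measurable_coupledSeq_right p n) (measurableSet_singleton s),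
    PMF.toMeasure_apply_singleton _ _ (measurableSet_singleton s), ← uniformSeq_coupledSeq p n s]
  rfl

lemma uniformSeq_coupledSeq_ne_le (p : ℕ → PMF S) (n : ℕ) :
    uniformSeq {r | coupledSeq p r n ≠ coupledSeq p r (n + 1)} ≤
      ENNReal.ofReal (tvDist (p n) (p (n + 1))) := by
  classical
  rw [← toReal_excess, ENNReal.ofReal_toReal (excess_ne_top _ _)]
  refine le_trans ?_ (sum_couplingWeight_ne _ _)
  have h : {r | coupledSeq p r n ≠ coupledSeq p r (n + 1)} ⊆
      ⋃ s ∈ (Finset.univ : Finset S), ⋃ t ∈ (Finset.univ : Finset S),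
        if s = t then ∅ else {r | coupledSeq p r n = s ∧ coupledSeq p r (n + 1) = t} := by
    intro r hr
    simp only [Set.mem_iUnion, Finset.mem_univ, exists_true_left]
    refine ⟨coupledSeq p r n, coupledSeq p r (n + 1), ?_⟩
    rw [if_neg hr]
    exact ⟨rfl, rfl⟩
  refine (measure_mono h).trans ((measure_biUnion_finset_le _ _).trans ?_)
  gcongr with s _
  refine (measure_biUnion_finset_le _ _).trans ?_
  gcongr with t _
  by_cases hst : s = t
  · simp [hst]
  · simp only [hst, if_false]
    rw [uniformSeq_coupledSeq_pair, uniformSeq_coupledSeq, mul_couplingRow]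

end Coupling

/-! ### Paths and propagation along a tree -/

section Paths

variable {V : Type*} {G : SimpleGraph V}

/-- The path between two vertices of a tree. -/
def treePath (hG : G.IsTree) (o v : V) : G.Walk o v := (hG.existsUnique_path o v).choose

variable (hG : G.IsTree)

lemma treePath_isPath (o v : V) : (treePath hG o v).IsPath :=
  (hG.existsUnique_path o v).choose_spec.1

lemma eq_treePath {o v : V} {p : G.Walk o v} (hp : p.IsPath) : p = treePath hG o v :=
  (hG.existsUnique_path o v).unique hp (treePath_isPath hG o v)

@[simp]
lemma treePath_self (o : V) : treePath hG o o = .nil :=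
  (eq_treePath hG .nil).symm

lemma treePath_of_notMem {o w a : V} (h : G.Adj o w) (ha : o ∉ (treePath hG w a).support) :
    treePath hG o a = .cons h (treePath hG w a) :=
  (eq_treePath hG ((treePath_isPath hG w a).cons ha)).symm

lemma treePath_of_mem {o w a : V} (h : G.Adj o w) (ha : o ∈ (treePath hG w a).support) :
    treePath hG w a = .cons h.symm (treePath hG o a) := by
  classical
  set p := treePath hG w a with hp
  have hpath : p.IsPath := treePath_isPath hG w a
  have h1 : p.takeUntil o ha = .cons h.symm .nil := by
    rw [eq_treePath hG (hpath.takeUntil ha)]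
    refine (eq_treePath hG ?_).symm
    simpa using h.ne'
  have h2 : p.dropUntil o ha = treePath hG o a := eq_treePath hG (hpath.dropUntil ha)
  conv_lhs => rw [← p.take_spec ha, h1, h2]
  rfl

lemma notMem_support_treePath {o w a : V} (h : G.Adj o w) (ha : o ∈ (treePath hG w a).support) :
    w ∉ (treePath hG o a).support := by
  have h1 := treePath_isPath hG w a
  rw [treePath_of_mem hG h ha, SimpleGraph.Walk.cons_isPath_iff] at h1
  exact h1.2

lemma start_notMem_tail (o a : V) : o ∉ (treePath hG o a).support.tail := by
  have h := (treePath_isPath hG o a).support_nodup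
  rw [← SimpleGraph.Walk.cons_tail_support, List.nodup_cons] at h
  exact h.1

/-- A path that starts at a neighbour of `w` and avoids `w` contains no other neighbour of `w`. -/
lemma adj_notMem_support {w u u' a : V} (h : G.Adj w u) (h' : G.Adj w u') (hne : u' ≠ u)
    (ha : w ∉ (treePath hG u a).support) : u' ∉ (treePath hG u a).support := by
  classical
  intro hmem
  have h1 : (treePath hG u a).takeUntil u' hmem = .cons h.symm (.cons h' .nil) := by
    rw [eq_treePath hG ((treePath_isPath hG u a).takeUntil hmem)]
    refine (eq_treePath hG ?_).symm
    simp [SimpleGraph.Walk.cons_isPath_iff, h.ne', h'.ne, hne.symm]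
  refine ha (SimpleGraph.Walk.support_takeUntil_subset_support _ hmem ?_)
  rw [h1]
  simp

lemma exists_adj_notMem_support {w a : V} (h : a ≠ w) :
    ∃ u, G.Adj w u ∧ w ∉ (treePath hG u a).support := by
  cases hp : treePath hG w a with
  | nil => exact absurd rfl h
  | cons hu p =>
    rename_i u
    have hpath := treePath_isPath hG w a
    rw [hp, SimpleGraph.Walk.cons_isPath_iff] at hpath
    obtain rfl := eq_treePath hG hpath.1
    exact ⟨u, hu, hpath.2⟩

lemma treePath_map (φ : G ≃g G) (o a : V) :
    treePath hG (φ o) (φ a) = (treePath hG o a).map φ.toHom :=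
  (eq_treePath hG (SimpleGraph.Walk.IsPath.map (f := φ.toHom) φ.injective
    (treePath_isPath hG o a))).symm

end Paths

section Propagation

variable {V S : Type*} {G : SimpleGraph V}

lemma stateAlong_congr {ξ ξ' : V → S → S} {u v : V} (p : G.Walk u v)
    (h : ∀ w ∈ p.support.tail, ξ w = ξ' w) (s : S) : stateAlong ξ s p = stateAlong ξ' s p := by
  induction p generalizing s with
  | nil => rfl
  | cons hu p ih =>
    simp only [stateAlong]
    rw [h _ (by simp)]
    refine ih (fun w hw => h w ?_) _
    simpa using List.mem_of_mem_tail hw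

lemma stateAlong_map (φ : G ≃g G) (ξ : V → S → S) {u v : V} (p : G.Walk u v) (s : S) :
    stateAlong ξ s (p.map φ.toHom) = stateAlong (fun w => ξ (φ w)) s p := by
  induction p generalizing s with
  | nil => rfl
  | cons hu p ih => exact ih _

lemma propagate_apply (hG : G.IsTree) (o : V) (z : S × (V → S → S)) (v : V) :
    propagate hG o z v = stateAlong z.2 z.1 (treePath hG o v) := rfl

lemma propagate_map (hG : G.IsTree) (φ : G ≃g G) (o : V) (s : S) (ξ : V → S → S) (v : V) :
    propagate hG (φ o) (s, ξ) (φ v) = propagate hG o (s, fun w => ξ (φ w)) v := by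
  rw [propagate_apply, propagate_apply, treePath_map, stateAlong_map]

open Classical in
/-- The labelling that is propagated from two adjacent vertices `o` and `w` in the states `s` and
`t`, each of them being the root of its side of the edge. -/
def propagateEdge (hG : G.IsTree) (o w : V) (s t : S) (ξ : V → S → S) (a : V) : S :=
  if o ∈ (treePath hG w a).support then stateAlong ξ s (treePath hG o a)
  else stateAlong ξ t (treePath hG w a)

lemma propagate_eq_propagateEdge_left (hG : G.IsTree) {o w : V} (h : G.Adj o w) (s : S)
    (ξ : V → S → S) : propagate hG o (s, ξ) = propagateEdge hG o w s (ξ w s) ξ := by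
  funext a
  by_cases ha : o ∈ (treePath hG w a).support
  · rw [propagateEdge, if_pos ha, propagate_apply]
  · rw [propagateEdge, if_neg ha, propagate_apply, treePath_of_notMem hG h ha]
    rfl

lemma propagate_eq_propagateEdge_right (hG : G.IsTree) {o w : V} (h : G.Adj o w) (t : S)
    (ξ : V → S → S) : propagate hG w (t, ξ) = propagateEdge hG o w (ξ o t) t ξ := by
  funext a
  by_cases ha : o ∈ (treePath hG w a).support
  · rw [propagateEdge, if_pos ha, propagate_apply, treePath_of_mem hG h ha]
    rfl
  · rw [propagateEdge, if_neg ha, propagate_apply]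

lemma propagateEdge_congr (hG : G.IsTree) {o w : V} (h : G.Adj o w) (s t : S)
    {ξ ξ' : V → S → S} (hξ : ∀ v, v ≠ o → v ≠ w → ξ v = ξ' v) :
    propagateEdge hG o w s t ξ = propagateEdge hG o w s t ξ' := by
  funext a
  by_cases ha : o ∈ (treePath hG w a).support
  · rw [propagateEdge, propagateEdge, if_pos ha, if_pos ha]
    refine stateAlong_congr _ (fun v hv => hξ v ?_ ?_) s
    · rintro rfl
      exact start_notMem_tail hG _ _ hv
    · rintro rfl
      exact notMem_support_treePath hG h ha (List.mem_of_mem_tail hv)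
  · rw [propagateEdge, propagateEdge, if_neg ha, if_neg ha]
    refine stateAlong_congr _ (fun v hv => hξ v ?_ ?_) t
    · rintro rfl
      exact ha (List.mem_of_mem_tail hv)
    · rintro rfl
      exact start_notMem_tail hG _ _ hv

variable [Finite S] [MeasurableSpace S] [DiscreteMeasurableSpace S]

lemma measurable_stateAlong {α : Type*} [MeasurableSpace α] {ξ : α → V → S → S} {s : α → S}
    (hξ : Measurable ξ) (hs : Measurable s) {u v : V} (p : G.Walk u v) :
    Measurable fun x => stateAlong (ξ x) (s x) p := by
  induction p generalizing s with
  | nil => exact hs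
  | cons hu p ih =>
    rename_i w _
    have h : Measurable fun q : (S → S) × S => q.1 q.2 :=
      measurable_from_prod_countable_left fun y => measurable_pi_apply y
    have h2 := h.comp (((measurable_pi_apply w).comp hξ).prodMk hs)
    exact ih (s := fun x => ξ x w (s x)) h2

lemma measurable_propagate (hG : G.IsTree) (o : V) :
    Measurable (propagate (S := S) hG o) :=
  measurable_pi_iff.2 fun _ => measurable_stateAlong measurable_snd measurable_fst _

lemma measurable_propagateEdge (hG : G.IsTree) (o w : V) (s t : S) :
    Measurable (propagateEdge hG o w s t) := by
  refine measurable_pi_iff.2 fun a => ?_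
  by_cases ha : o ∈ (treePath hG w a).support
  · simp only [propagateEdge, if_pos ha]
    exact measurable_stateAlong measurable_id measurable_const _
  · simp only [propagateEdge, if_neg ha]
    exact measurable_stateAlong measurable_id measurable_const _

end Propagation

/-! ### Reversibility and the Markov property of the branching process -/

section Outward

variable {V S : Type*} {G : SimpleGraph V} [G.LocallyFinite]

lemma prod_neighborFinset {w : V} (f : V → ℝ≥0∞) :
    ∏ u ∈ G.neighborFinset w, f u = ∏ u : G.neighborSet w, f u := by
  rw [SimpleGraph.neighborFinset_def, Set.toFinset, Finset.prod_map]
  rfl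

/-- The update maps away from `w` and its neighbours produce the states `σ` on `A`, if the
neighbours of `w` have their states from `σ`. -/
def outwardEvent (hG : G.IsTree) (w : V) (A : Finset V) (σ : V → S) : Set (V → S → S) :=
  {ξ | ∀ a ∈ A, ∀ u ∈ G.neighborFinset w, w ∉ (treePath hG u a).support →
    stateAlong ξ (σ u) (treePath hG u a) = σ a}

lemma outwardEvent_congr (hG : G.IsTree) (w : V) (A : Finset V) (σ : V → S)
    {ξ ξ' : V → S → S} (h : ∀ v, v ∉ G.neighborFinset w → ξ v = ξ' v)
    (hξ : ξ ∈ outwardEvent hG w A σ) : ξ' ∈ outwardEvent hG w A σ := by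
  intro a ha u hu hw
  rw [← hξ a ha u hu hw]
  refine stateAlong_congr _ (fun v hv => (h v fun hv' => ?_).symm) _
  rw [SimpleGraph.mem_neighborFinset] at hu hv'
  by_cases hvu : v = u
  · subst hvu
    exact start_notMem_tail hG _ _ hv
  · exact adj_notMem_support hG hu hv' hvu hw (List.mem_of_mem_tail hv)

lemma outwardEvent_neighborFinset (hG : G.IsTree) (w : V) (σ : V → S) :
    outwardEvent hG w (G.neighborFinset w) σ = Set.univ := by
  refine Set.eq_univ_of_forall fun ξ a ha u hu hw => ?_
  rw [SimpleGraph.mem_neighborFinset] at ha hu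
  by_cases hau : a = u
  · subst hau
    rw [treePath_self]
    rfl
  · exact absurd (SimpleGraph.Walk.end_mem_support _) (adj_notMem_support hG hu ha hau hw)

/-- The event that the process rooted at `w`, started in the state `s`, has the states `σ` on a
finite set that contains all neighbours of `w`. -/
lemma propagate_eq_iff (hG : G.IsTree) (w : V) {A : Finset V} (hA : G.neighborFinset w ⊆ A)
    (hw : w ∉ A) (σ : V → S) (s : S) (ξ : V → S → S) :
    (∀ a ∈ A, propagate hG w (s, ξ) a = σ a) ↔
      (∀ u ∈ G.neighborFinset w, ξ u s = σ u) ∧ ξ ∈ outwardEvent hG w A σ := by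
  have hnb : ∀ {u a : V} (hu : G.Adj w u), w ∉ (treePath hG u a).support →
      propagate hG w (s, ξ) a = stateAlong ξ (ξ u s) (treePath hG u a) := by
    intro u a hu hw'
    rw [propagate_apply, treePath_of_notMem hG hu hw']
    rfl
  constructor
  · intro h
    have h1 : ∀ u ∈ G.neighborFinset w, ξ u s = σ u := by
      intro u hu
      have hadj := (SimpleGraph.mem_neighborFinset _ _ _).1 hu
      rw [← h u (hA hu), hnb hadj (by simpa using hadj.ne), treePath_self]
      rfl
    refine ⟨h1, fun a ha u hu hw' => ?_⟩
    rw [← h a ha, hnb ((SimpleGraph.mem_neighborFinset _ _ _).1 hu) hw', h1 u hu]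
  · rintro ⟨h1, h2⟩ a ha
    obtain ⟨u, hu, hwu⟩ := exists_adj_notMem_support hG (w := w) (a := a)
      (fun h => hw (h ▸ ha))
    have hu' := (SimpleGraph.mem_neighborFinset _ _ _).2 hu
    rw [hnb hu hwu, h1 u hu']
    exact h2 a ha u hu' hwu

end Outward

section BranchingProcess

variable {V S : Type*} {G : SimpleGraph V} [Fintype S] [MeasurableSpace S]
  [DiscreteMeasurableSpace S]

/-- The law of the update maps `ξ` of the branching Markov process. -/
def updateLaw (V : Type*) (Q : S → PMF S) : Measure (V → S → S) :=
  Measure.infinitePi fun _ : V => Measure.pi fun s => (Q s).toMeasure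

instance (Q : S → PMF S) : IsProbabilityMeasure (updateLaw V Q) := by
  unfold updateLaw; infer_instance

instance (hG : G.IsTree) (o : V) (π : PMF S) (Q : S → PMF S) :
    IsProbabilityMeasure (branchingMarkov hG o π Q) := by
  have : IsProbabilityMeasure (branchingNoise V π Q) := by unfold branchingNoise; infer_instance
  exact Measure.isProbabilityMeasure_map (measurable_propagate hG o).aemeasurable

lemma pi_update_apply (Q : S → PMF S) (s t : S) :
    (Measure.pi fun s => (Q s).toMeasure) {f : S → S | f s = t} = Q s t := by
  have h := (measurePreserving_eval (fun s => (Q s).toMeasure) s).measure_preimage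
    (measurableSet_singleton t).nullMeasurableSet
  rw [PMF.toMeasure_apply_singleton _ _ (measurableSet_singleton t)] at h
  exact h

lemma measurable_propagate_right (hG : G.IsTree) (o : V) (s : S) :
    Measurable fun ξ => propagate hG o (s, ξ) :=
  (measurable_propagate hG o).comp measurable_prodMk_left

lemma branchingMarkov_apply (hG : G.IsTree) (o : V) (π : PMF S) (Q : S → PMF S)
    {C : Set (V → S)} (hC : MeasurableSet C) :
    branchingMarkov hG o π Q C =
      ∑ s, π s * updateLaw V Q {ξ | propagate hG o (s, ξ) ∈ C} := by
  rw [branchingMarkov, Measure.map_apply (measurable_propagate hG o) hC, branchingNoise,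
    Measure.prod_apply (measurable_propagate hG o hC), lintegral_fintype]
  refine Finset.sum_congr rfl fun s _ => ?_
  rw [PMF.toMeasure_apply_singleton _ _ (measurableSet_singleton s), mul_comm]
  rfl

lemma updateLaw_and (Q : S → PMF S) (w : V) (s t : S) {E : Set (V → S → S)}
    (hE : MeasurableSet E)
    (hw : ∀ ξ ξ' : V → S → S, (∀ v, v ≠ w → ξ v = ξ' v) → ξ ∈ E → ξ' ∈ E) :
    updateLaw V Q {ξ | ξ w s = t ∧ ξ ∈ E} = Q s t * updateLaw V Q E := by
  have hm : MeasurableSet {f : S → S | f s = t} :=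
    measurableSet_eq_const (f := fun f : S → S => f s) (measurable_pi_apply s) t
  have h := infinitePi_pi_inter (fun _ : V => Measure.pi fun s => (Q s).toMeasure) {w}
    (t := fun _ => {f | f s = t}) (fun _ => hm) hE (fun ξ ξ' h => hw ξ ξ' (by simpa using h))
  rw [Finset.prod_singleton, pi_update_apply] at h
  rw [updateLaw, ← h]
  congr 1
  ext ξ
  simp

/-- Across an edge the branching Markov process is symmetric in form: the states of the two
end vertices are a step of the stationary chain, and both sides of the edge evolve from there. -/
lemma branchingMarkov_apply_edge_left (hG : G.IsTree) {o w : V} (h : G.Adj o w) (π : PMF S)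
    (Q : S → PMF S) {C : Set (V → S)} (hC : MeasurableSet C) :
    branchingMarkov hG o π Q C =
      ∑ s, ∑ t, π s * Q s t * updateLaw V Q {ξ | propagateEdge hG o w s t ξ ∈ C} := by
  rw [branchingMarkov_apply hG o π Q hC]
  refine Finset.sum_congr rfl fun s _ => ?_
  simp_rw [mul_assoc, ← Finset.mul_sum]
  congr 1
  have hE (t : S) : MeasurableSet {ξ | propagateEdge hG o w s t ξ ∈ C} :=
    measurable_propagateEdge hG o w s t hC
  have hset : {ξ | propagate hG o (s, ξ) ∈ C} =
      ⋃ t, {ξ | ξ w s = t ∧ ξ ∈ {ξ | propagateEdge hG o w s t ξ ∈ C}} := by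
    ext ξ
    simp [propagate_eq_propagateEdge_left hG h]
  have hev (t : S) : MeasurableSet {ξ : V → S → S | ξ w s = t} :=
    measurableSet_eq_const (f := fun ξ : V → S → S => ξ w s) (by fun_prop) t
  rw [hset, measure_iUnion, tsum_fintype]
  · refine Finset.sum_congr rfl fun t _ => updateLaw_and Q w s t (hE t) fun ξ ξ' hξ hmem => ?_
    rw [Set.mem_ofPred_eq] at hmem ⊢
    rwa [propagateEdge_congr hG h s t fun v _ hv => (hξ v hv).symm]
  · intro t t' htt'
    exact Set.disjoint_left.2 fun ξ h1 h2 => htt' (h1.1.symm.trans h2.1)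
  · exact fun t => (hev t).inter (hE t)

lemma branchingMarkov_apply_edge_right (hG : G.IsTree) {o w : V} (h : G.Adj o w) (π : PMF S)
    (Q : S → PMF S) {C : Set (V → S)} (hC : MeasurableSet C) :
    branchingMarkov hG w π Q C =
      ∑ t, ∑ s, π t * Q t s * updateLaw V Q {ξ | propagateEdge hG o w s t ξ ∈ C} := by
  rw [branchingMarkov_apply hG w π Q hC]
  refine Finset.sum_congr rfl fun t _ => ?_
  simp_rw [mul_assoc, ← Finset.mul_sum]
  congr 1
  have hE (s : S) : MeasurableSet {ξ | propagateEdge hG o w s t ξ ∈ C} :=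
    measurable_propagateEdge hG o w s t hC
  have hset : {ξ | propagate hG w (t, ξ) ∈ C} =
      ⋃ s, {ξ | ξ o t = s ∧ ξ ∈ {ξ | propagateEdge hG o w s t ξ ∈ C}} := by
    ext ξ
    simp [propagate_eq_propagateEdge_right hG h]
  have hev (s : S) : MeasurableSet {ξ : V → S → S | ξ o t = s} :=
    measurableSet_eq_const (f := fun ξ : V → S → S => ξ o t) (by fun_prop) s
  rw [hset, measure_iUnion, tsum_fintype]
  · refine Finset.sum_congr rfl fun s _ => updateLaw_and Q o t s (hE s) fun ξ ξ' hξ hmem => ?_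
    rw [Set.mem_ofPred_eq] at hmem ⊢
    rwa [propagateEdge_congr hG h s t fun v hv _ => (hξ v hv).symm]
  · intro s s' hss'
    exact Set.disjoint_left.2 fun ξ h1 h2 => hss' (h1.1.symm.trans h2.1)
  · exact fun s => (hev s).inter (hE s)

/-- By reversibility, the law of the branching Markov process does not depend on the root. -/
theorem branchingMarkov_root (hG : G.IsTree) {π : PMF S} {Q : S → PMF S}
    (hrev : IsReversible π Q) (o w : V) :
    branchingMarkov hG o π Q = branchingMarkov hG w π Q := by
  obtain ⟨p⟩ := hG.connected.preconnected o w
  induction p with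
  | nil => rfl
  | cons h p ih =>
    rw [← ih]
    refine Measure.ext fun C hC => ?_
    rw [branchingMarkov_apply_edge_left hG h π Q hC, branchingMarkov_apply_edge_right hG h π Q hC,
      Finset.sum_comm]
    exact Finset.sum_congr rfl fun t _ => Finset.sum_congr rfl fun s _ => by rw [hrev s t]

lemma map_branchingMarkov_apply_root (hG : G.IsTree) (π : PMF S) (Q : S → PMF S) (φ : G ≃g G)
    (o : V) :
    (branchingMarkov hG (φ o) π Q).map (fun x u => x (φ u)) = branchingMarkov hG o π Q := by
  have hm : Measurable fun (x : V → S) u => x (φ u) := by fun_prop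
  have hm' : Measurable fun (ξ : V → S → S) u => ξ (φ u) := by fun_prop
  refine Measure.ext fun C hC => ?_
  rw [Measure.map_apply hm hC, branchingMarkov_apply _ _ _ _ (hm hC),
    branchingMarkov_apply _ _ _ _ hC]
  refine Finset.sum_congr rfl fun s _ => ?_
  congr 1
  have h : (updateLaw V Q).map (fun ξ u => ξ (φ u)) = updateLaw V Q :=
    Measure.map_infinitePi_infinitePi_of_inj φ.injective
  have hE : MeasurableSet {ξ | propagate hG o (s, ξ) ∈ C} := measurable_propagate_right hG o s hC
  conv_rhs => rw [← h, Measure.map_apply hm' hE]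
  congr 1
  ext ξ
  have : (fun u => propagate hG (φ o) (s, ξ) (φ u)) = propagate hG o (s, fun w => ξ (φ w)) :=
    funext fun u => propagate_map hG φ o s ξ u
  simp only [Set.mem_ofPred_eq, Set.mem_preimage, this]

/-- The branching Markov process is invariant under the automorphisms of the tree. -/
theorem branchingMarkov_mem_invariantProcesses (hG : G.IsTree) {π : PMF S} {Q : S → PMF S}
    (hrev : IsReversible π Q) (o : V) :
    branchingMarkov hG o π Q ∈ invariantProcesses G S := by
  refine ⟨inferInstance, fun φ => ?_⟩
  conv_lhs => rw [branchingMarkov_root hG hrev o (φ o)]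
  exact map_branchingMarkov_apply_root hG π Q φ o

/-! ### The Markov property -/

variable [G.LocallyFinite]

lemma measurableSet_outwardEvent (hG : G.IsTree) (w : V) (A : Finset V) (σ : V → S) :
    MeasurableSet (outwardEvent hG w A σ) := by
  have : outwardEvent hG w A σ = ⋂ a ∈ A, ⋂ u ∈ G.neighborFinset w,
      {ξ | w ∉ (treePath hG u a).support →
        stateAlong ξ (σ u) (treePath hG u a) = σ a} := by
    ext ξ
    simp [outwardEvent]
  rw [this]
  refine Finset.measurableSet_biInter _ fun a _ => Finset.measurableSet_biInter _ fun u _ => ?_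
  by_cases h : w ∈ (treePath hG u a).support
  · simp [h]
  · simp only [h, not_false_eq_true, true_imp_iff]
    exact measurableSet_eq_const (measurable_stateAlong measurable_id measurable_const _) (σ a)

lemma branchingMarkov_cylinder (hG : G.IsTree) {π : PMF S} {Q : S → PMF S}
    (hrev : IsReversible π Q) (o w : V) {A : Finset V} (hA : G.neighborFinset w ⊆ A)
    (hw : w ∉ A) (σ : V → S) (s : S) :
    branchingMarkov hG o π Q {x | x w = s ∧ ∀ a ∈ A, x a = σ a} =
      (π s * ∏ u ∈ G.neighborFinset w, Q s (σ u)) * updateLaw V Q (outwardEvent hG w A σ) := by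
  have hms : MeasurableSet {x : V → S | x w = s ∧ ∀ a ∈ A, x a = σ a} :=
    measurableSet_eq_and_cylinder w s A σ
  rw [branchingMarkov_root hG hrev o w, branchingMarkov_apply hG w π Q hms,
    Finset.sum_eq_single s, mul_assoc]
  · congr 1
    have h := infinitePi_pi_inter (fun _ : V => Measure.pi fun s => (Q s).toMeasure)
      (G.neighborFinset w) (t := fun u => {f | f s = σ u})
      (fun u => measurableSet_eq_const (measurable_pi_apply s) _)
      (measurableSet_outwardEvent hG w A σ) (fun ξ ξ' h => outwardEvent_congr hG w A σ h)
    simp_rw [pi_update_apply] at h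
    rw [updateLaw, ← h]
    congr 1
    ext ξ
    simp only [Set.mem_ofPred_eq, propagate_eq_iff hG w hA hw, Set.mem_inter_iff, Set.mem_pi,
      Finset.mem_coe]
    simp [propagate_apply, stateAlong]
  · intro t _ hts
    have : {ξ | propagate hG w (t, ξ) ∈ {x : V → S | x w = s ∧ ∀ a ∈ A, x a = σ a}} = ∅ := by
      refine Set.eq_empty_of_forall_notMem fun ξ hξ => hts ?_
      have := hξ.1
      rwa [propagate_apply, treePath_self] at this
    rw [this, measure_empty, mul_zero]
  · simp

/-- `b` is a conditional distribution of the state of `w`, given the states of its neighbours: it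
satisfies Bayes' rule for the weights `π s * ∏ u, Q s (ω u)`. -/
def IsBayes (π : PMF S) (Q : S → PMF S) {w : V} (b : (G.neighborSet w → S) → PMF S) : Prop :=
  ∀ ω s, π s * ∏ u, Q s (ω u) = (∑ t, π t * ∏ u, Q t (ω u)) * b ω s

lemma measure_cylinder_eq_sum {μ : Measure (V → S)} (w : V) (A : Finset V) (σ : V → S) :
    μ {x | ∀ a ∈ A, x a = σ a} = ∑ t, μ {x | x w = t ∧ ∀ a ∈ A, x a = σ a} := by
  have h : {x : V → S | ∀ a ∈ A, x a = σ a} = ⋃ t, {x | x w = t ∧ ∀ a ∈ A, x a = σ a} := by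
    ext x; simp
  rw [h, measure_iUnion, tsum_fintype]
  · intro t t' htt'
    exact Set.disjoint_left.2 fun x h1 h2 => htt' (h1.1.symm.trans h2.1)
  · exact fun t => measurableSet_eq_and_cylinder w t A σ

lemma IsConditionalLaw.isBayes (hG : G.IsTree) {π : PMF S} {Q : S → PMF S}
    (hrev : IsReversible π Q) {o w : V} {b : (G.neighborSet w → S) → PMF S}
    (hb : IsConditionalLaw G (branchingMarkov hG o π Q) w b) : IsBayes π Q b := by
  classical
  intro ω s
  let σ : V → S := fun u => if hu : u ∈ G.neighborSet w then ω ⟨u, hu⟩ else s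
  have hσ (u : G.neighborSet w) : σ u = ω u := dif_pos u.2
  have h1 (x : V → S) :
      (∀ u : G.neighborSet w, x u = ω u) ↔ ∀ a ∈ G.neighborFinset w, x a = σ a := by
    simp only [Subtype.forall, SimpleGraph.mem_neighborFinset, SimpleGraph.mem_neighborSet]
    refine forall₂_congr fun a ha => ?_
    rw [← hσ ⟨a, ha⟩]
  have h := hb ω s
  simp_rw [h1] at h
  have hc (t : S) := branchingMarkov_cylinder hG hrev o w (Finset.Subset.refl _) (by simp) σ t
  rw [measure_cylinder_eq_sum w] at h
  simp_rw [hc, outwardEvent_neighborFinset, measure_univ, mul_one, prod_neighborFinset, hσ] at h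
  exact h

/-- The spatial Markov property: given the states on a finite set `A` that contains all neighbours
of `w`, the state of `w` has the distribution `b`. -/
theorem branchingMarkov_markov (hG : G.IsTree) {π : PMF S} {Q : S → PMF S}
    (hrev : IsReversible π Q) (o : V) {w : V} {b : (G.neighborSet w → S) → PMF S}
    (hb : IsBayes π Q b) {A : Finset V} (hA : G.neighborFinset w ⊆ A) (hw : w ∉ A)
    (σ : V → S) :
    branchingMarkov hG o π Q {x | x w = σ w ∧ ∀ a ∈ A, x a = σ a} =
      branchingMarkov hG o π Q {x | ∀ a ∈ A, x a = σ a} * b (fun u => σ u) (σ w) := by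
  rw [measure_cylinder_eq_sum w]
  simp_rw [branchingMarkov_cylinder hG hrev o w hA hw, prod_neighborFinset]
  rw [← Finset.sum_mul, hb (fun u => σ u) (σ w)]
  ring

end BranchingProcess

/-! ### The symmetrized local rule -/

section TotalVariation

lemma toReal_bind_uniformOfFintype {S ι : Type*} [Fintype ι] [Nonempty ι] (p : ι → PMF S) (s : S) :
    ((PMF.uniformOfFintype ι).bind p s).toReal =
      (Fintype.card ι : ℝ)⁻¹ * ∑ i, (p i s).toReal := by
  rw [PMF.bind_apply, tsum_fintype, ENNReal.toReal_sum fun i _ =>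
    ENNReal.mul_ne_top (PMF.apply_ne_top _ _) (PMF.apply_ne_top _ _), Finset.mul_sum]
  simp

variable {S : Type*} [Fintype S]

lemma tvDist_self (p : PMF S) : tvDist p p = 0 := by simp [tvDist]

lemma tvDist_triangle (p q r : PMF S) : tvDist p r ≤ tvDist p q + tvDist q r := by
  rw [tvDist, tvDist, tvDist, ← mul_add, ← Finset.sum_add_distrib]
  gcongr with s _
  exact abs_sub_le _ _ _

lemma tvDist_nonneg (p q : PMF S) : 0 ≤ tvDist p q := by
  unfold tvDist; positivity

lemma tvDist_le_one (p q : PMF S) : tvDist p q ≤ 1 := by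
  have h (p : PMF S) : ∑ s, (p s).toReal = 1 := by
    rw [← ENNReal.toReal_sum fun s _ => p.apply_ne_top s, sum_pmf_apply, ENNReal.toReal_one]
  have h2 : ∑ s, |(p s).toReal - (q s).toReal| ≤ ∑ s, ((p s).toReal + (q s).toReal) := by
    gcongr with s _
    rw [abs_le]
    constructor <;> linarith [ENNReal.toReal_nonneg (a := p s), ENNReal.toReal_nonneg (a := q s)]
  rw [Finset.sum_add_distrib, h, h] at h2
  unfold tvDist
  linarith

/-- Total variation is convex. -/
lemma tvDist_bind_le {ι : Type*} [Fintype ι] [Nonempty ι] (p q : ι → PMF S) {C : ℝ}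
    (h : ∀ i, tvDist (p i) (q i) ≤ C) :
    tvDist ((PMF.uniformOfFintype ι).bind p) ((PMF.uniformOfFintype ι).bind q) ≤ C := by
  have hc : (0 : ℝ) < Fintype.card ι := by exact_mod_cast Fintype.card_pos
  calc tvDist ((PMF.uniformOfFintype ι).bind p) ((PMF.uniformOfFintype ι).bind q)
      ≤ (Fintype.card ι : ℝ)⁻¹ * ∑ i, tvDist (p i) (q i) := by
        simp only [tvDist, toReal_bind_uniformOfFintype]
        rw [← Finset.mul_sum, Finset.sum_comm, mul_left_comm]
        gcongr
        rw [Finset.mul_sum]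
        gcongr with s _
        rw [← mul_sub, abs_mul, abs_of_nonneg (by positivity), ← Finset.sum_sub_distrib]
        gcongr
        exact Finset.abs_sum_le_sum_abs _ _
    _ ≤ (Fintype.card ι : ℝ)⁻¹ * ∑ _i : ι, C := by
        gcongr with i _
        exact h i
    _ = C := by
        rw [Finset.sum_const, Finset.card_univ, nsmul_eq_mul]
        field_simp

end TotalVariation

section DobrushinCoefficient

variable {V S : Type*} {G : SimpleGraph V} [Fintype S]

lemma dobrushinCoeff_nonneg {v : V} (B : (G.neighborSet v → S) → PMF S) :
    0 ≤ dobrushinCoeff B := by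
  refine Real.sSup_nonneg ?_
  rintro r ⟨ω, ω', -, rfl⟩
  exact tvDist_nonneg _ _

lemma tvDist_le_dobrushinCoeff {v : V} (B : (G.neighborSet v → S) → PMF S)
    {ω ω' : G.neighborSet v → S} (h : ∃! u, ω u ≠ ω' u) :
    tvDist (B ω) (B ω') ≤ dobrushinCoeff B := by
  refine le_csSup ⟨1, ?_⟩ ⟨ω, ω', h, rfl⟩
  rintro r ⟨ω, ω', -, rfl⟩
  exact tvDist_le_one _ _

/-- The states of the vertices in `T` can be changed one at a time. -/
lemma tvDist_le_mul_card {v : V} (B : (G.neighborSet v → S) → PMF S)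
    (T : Finset (G.neighborSet v)) (ω ω' : G.neighborSet v → S) (h : ∀ u ∉ T, ω u = ω' u) :
    tvDist (B ω) (B ω') ≤ dobrushinCoeff B * T.card := by
  classical
  induction T using Finset.induction_on generalizing ω' with
  | empty =>
    have : ω = ω' := funext fun u => h u (by simp)
    simp [this, tvDist_self]
  | insert u T hu ih =>
    -- change the state of `u` last
    set ω'' := Function.update ω' u (ω u) with hω''
    have h1 : tvDist (B ω) (B ω'') ≤ dobrushinCoeff B * T.card := by
      refine ih ω'' fun u' hu' => ?_
      by_cases huu : u' = u
      · subst huu; simp [hω'']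
      · rw [hω'', Function.update_of_ne huu]
        exact h u' (by simp [huu, hu'])
    have h2 : tvDist (B ω'') (B ω') ≤ dobrushinCoeff B := by
      by_cases huu : ω u = ω' u
      · have : ω'' = ω' := by rw [hω'', huu, Function.update_eq_self]
        rw [this, tvDist_self]
        exact dobrushinCoeff_nonneg B
      · refine tvDist_le_dobrushinCoeff B ⟨u, by simpa [hω''] using huu, fun u' hu' => ?_⟩
        by_contra hne
        exact hu' (by rw [hω'', Function.update_of_ne hne])
    rw [Finset.card_insert_of_notMem hu]
    push_cast
    linarith [tvDist_triangle (B ω) (B ω'') (B ω')]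

end DobrushinCoefficient

section LocalRule

variable {V S : Type*} {G : SimpleGraph V} [G.LocallyFinite]

open Classical in
/-- The rule `B` for the vertex `v`, carried over to the vertex `w` by a uniformly random bijection
of the neighbourhoods. On neighbourhoods of positive probability it agrees with `B`; the averaging
makes it equivariant on all of them, also where `B` was arbitrary. -/
def averagedRule {v : V} (B : (G.neighborSet v → S) → PMF S) (w : V)
    [Nonempty (G.neighborSet v ≃ G.neighborSet w)] (ω : G.neighborSet w → S) : PMF S :=
  (PMF.uniformOfFintype (G.neighborSet v ≃ G.neighborSet w)).bind fun e => B (ω ∘ e)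

lemma averagedRule_map {v : V} (B : (G.neighborSet v → S) → PMF S)
    [∀ w, Nonempty (G.neighborSet v ≃ G.neighborSet w)] (φ : G ≃g G) (w : V) (x : V → S) :
    averagedRule B (φ w) (fun u => x u) = averagedRule B w (fun u => x (φ u)) := by
  classical
  let ψ : G.neighborSet w ≃ G.neighborSet (φ w) := φ.mapNeighborSet w
  ext s
  simp only [averagedRule, PMF.bind_apply, tsum_fintype, PMF.uniformOfFintype_apply]
  -- the bijections onto the two neighbourhoods correspond to each other under `φ`
  refine (Fintype.sum_equiv (Equiv.equivCongr (Equiv.refl _) ψ) _ _ fun e => ?_).symm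
  rw [Fintype.card_congr (Equiv.equivCongr (Equiv.refl (G.neighborSet v)) ψ)]
  congr 1

variable [Fintype S]

lemma averagedRule_isBayes {v : V} {B : (G.neighborSet v → S) → PMF S} {π : PMF S}
    {Q : S → PMF S} (hB : IsBayes π Q B) (w : V)
    [Nonempty (G.neighborSet v ≃ G.neighborSet w)] : IsBayes π Q (averagedRule B w) := by
  classical
  intro ω s
  have h (e : G.neighborSet v ≃ G.neighborSet w) :
      π s * ∏ u, Q s (ω u) = (∑ t, π t * ∏ u, Q t (ω u)) * B (ω ∘ e) s := by
    have he (t : S) : ∏ u, Q t ((ω ∘ e) u) = ∏ u, Q t (ω u) :=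
      Fintype.prod_equiv e _ _ fun _ => rfl
    have h1 := hB (ω ∘ e) s
    simp_rw [he] at h1
    exact h1
  simp only [averagedRule, PMF.bind_apply, tsum_fintype]
  rw [Finset.mul_sum]
  simp_rw [mul_left_comm _ (PMF.uniformOfFintype _ _), ← h, ← Finset.sum_mul]
  rw [sum_pmf_apply, one_mul]

lemma tvDist_averagedRule_le {v : V} (B : (G.neighborSet v → S) → PMF S) (w : V)
    [Nonempty (G.neighborSet v ≃ G.neighborSet w)] (T : Finset (G.neighborSet w))
    (ω ω' : G.neighborSet w → S) (h : ∀ u ∉ T, ω u = ω' u) :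
    tvDist (averagedRule B w ω) (averagedRule B w ω') ≤ dobrushinCoeff B * T.card := by
  classical
  refine tvDist_bind_le _ _ fun e => ?_
  have h1 := tvDist_le_mul_card B (T.map e.symm.toEmbedding) (ω ∘ e) (ω' ∘ e) fun u hu => by
    refine h _ fun hT => hu ?_
    rw [Finset.mem_map]
    exact ⟨e u, hT, by simp⟩
  rwa [Finset.card_map] at h1

end LocalRule

/-! ### Heat bath dynamics -/

section Glauber

/-- A fair coin. -/
def fairCoin : Measure Bool := (PMF.uniformOfFintype Bool).toMeasure

instance : IsProbabilityMeasure fairCoin := by unfold fairCoin; infer_instance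

lemma fairCoin_singleton (c : Bool) : fairCoin {c} = 2⁻¹ := by
  rw [fairCoin, PMF.toMeasure_apply_singleton _ _ (measurableSet_singleton c)]
  simp

/-- The randomness used at a vertex in one step: a coin that decides whether the vertex asks for an
update, and the driving variables of a coupled sequence. -/
abbrev SiteNoise := Bool × (ℕ → unitInterval)

/-- The law of the randomness used in one step. -/
def noiseLaw (V : Type*) : Measure (V → SiteNoise) :=
  Measure.infinitePi fun _ : V => fairCoin.prod uniformSeq

instance (V : Type*) : IsProbabilityMeasure (noiseLaw V) := by
  unfold noiseLaw; infer_instance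

variable {V S : Type*} (G : SimpleGraph V) [G.LocallyFinite]

/-- A vertex is updated if it asks for an update and none of its neighbours does. The updated
vertices form an independent set. -/
def IsUpdated (η : V → Bool) (w : V) : Prop :=
  η w = true ∧ ∀ u ∈ G.neighborFinset w, η u = false

lemma measurableSet_isUpdated (w : V) : MeasurableSet {η : V → Bool | IsUpdated G η w} := by
  have : {η : V → Bool | IsUpdated G η w} =
      {η | η w = true ∧ ∀ u ∈ G.neighborFinset w, η u = (fun _ => false) u} := rfl
  rw [this]
  exact measurableSet_eq_and_cylinder _ _ _ _

open Classical in
/-- The labelling that is `a` at the updated vertices and `x` elsewhere. -/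
def resample (η : V → Bool) (a x : V → S) (w : V) : S := if IsUpdated G η w then a w else x w

lemma measurable_resample [MeasurableSpace S] :
    Measurable fun q : (V → Bool) × (V → S) × (V → S) => resample G q.1 q.2.1 q.2.2 := by
  refine measurable_pi_iff.2 fun w => ?_
  refine Measurable.ite (measurable_fst (measurableSet_isUpdated G w)) ?_ ?_
  · fun_prop
  · fun_prop

variable {G}
variable [Fintype S] [MeasurableSpace S] [DiscreteMeasurableSpace S]
variable (b : ∀ w : V, (G.neighborSet w → S) → PMF S)

/-! ### Markov random fields and stationarity -/

/-- `ν` is a Markov random field whose conditional distributions at a vertex, given the other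
vertices, are given by `b`. -/
def IsMarkovField (ν : Measure (V → S)) : Prop :=
  ∀ (w : V) (A : Finset V) (σ : V → S), G.neighborFinset w ⊆ A → w ∉ A →
    ν {x | x w = σ w ∧ ∀ a ∈ A, x a = σ a} =
      ν {x | ∀ a ∈ A, x a = σ a} * b w (fun u => σ u) (σ w)

open Classical in
lemma lintegral_mul_rule {ν : Measure (V → S)} (hν : IsMarkovField b ν) {w : V} {A : Finset V}
    (hw : w ∉ A) (s : S) {f : (V → S) → ℝ≥0∞}
    (hf : ∀ x y : V → S, (∀ a ∈ A, x a = y a) → f x = f y) :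
    ∫⁻ x, f x * b w (fun u => x u) s ∂ν = ∫⁻ x, f x * (if x w = s then 1 else 0) ∂ν := by
  set A' : Finset V := A ∪ G.neighborFinset w with hA'
  have hwA' : w ∉ A' := by simp [hA', hw]
  -- split the space according to the states on `A'`
  let ext : (A' → S) → V → S := fun τ v => if hv : v ∈ A' then τ ⟨v, hv⟩ else s
  have hext (τ : A' → S) : ext τ w = s := by simp [ext, hwA']
  let C : (A' → S) → Set (V → S) := fun τ => {x | ∀ a ∈ A', x a = ext τ a}
  have hC (τ : A' → S) : MeasurableSet (C τ) := measurableSet_cylinder A' (ext τ)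
  have hCd : Pairwise (Function.onFun Disjoint C) := by
    intro τ τ' hττ'
    refine Set.disjoint_left.2 fun x h1 h2 => hττ' (funext fun a => ?_)
    have := (h1 a a.2).symm.trans (h2 a a.2)
    simpa [ext] using this
  have hCu : ⋃ τ, C τ = Set.univ := by
    refine Set.eq_univ_of_forall fun x => Set.mem_iUnion.2 ⟨fun a => x a, fun a ha => ?_⟩
    simp [ext, ha]
  have hsplit (g : (V → S) → ℝ≥0∞) : ∫⁻ x, g x ∂ν = ∑ τ, ∫⁻ x in C τ, g x ∂ν := by
    rw [← setLIntegral_univ, ← hCu, lintegral_iUnion hC hCd, tsum_fintype]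
  rw [hsplit, hsplit]
  refine Finset.sum_congr rfl fun τ _ => ?_
  have hfx {x : V → S} (hx : x ∈ C τ) : f x = f (ext τ) :=
    hf _ _ fun a ha => hx a (Finset.mem_union_left _ ha)
  have hbx {x : V → S} (hx : x ∈ C τ) : b w (fun u => x u) s = b w (fun u => ext τ u) s := by
    congr 2
    funext u
    exact hx u (Finset.mem_union_right _ ((SimpleGraph.mem_neighborFinset _ _ _).2 u.2))
  have hms : MeasurableSet {x : V → S | x w = s} :=
    measurableSet_eq_const (f := fun x : V → S => x w) (measurable_pi_apply w) s
  have hl : ∫⁻ x in C τ, f x * b w (fun u => x u) s ∂ν =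
      f (ext τ) * b w (fun u => ext τ u) s * ν (C τ) := by
    rw [← setLIntegral_const]
    exact setLIntegral_congr_fun (hC τ) fun x hx => by simp only [hfx hx, hbx hx]
  have hr : ∫⁻ x in C τ, f x * (if x w = s then 1 else 0) ∂ν =
      f (ext τ) * ν ({x | x w = s} ∩ C τ) := by
    rw [← Measure.restrict_apply hms, ← lintegral_indicator_one hms,
      ← lintegral_const_mul _ (measurable_one.indicator hms)]
    exact setLIntegral_congr_fun (hC τ) fun x hx => by simp [hfx hx, Set.indicator]
  rw [hl, hr]
  have h := hν w A' (ext τ) Finset.subset_union_right hwA'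
  rw [hext] at h
  have hset : {x : V → S | x w = s} ∩ C τ = {x | x w = s ∧ ∀ a ∈ A', x a = ext τ a} := rfl
  rw [hset, h, mul_assoc, mul_comm (b w _ s)]

/-- The law of the labelling after one step from `x`. -/
def stepLaw (x : V → S) : Measure (V → S) :=
  ((Measure.infinitePi fun _ : V => fairCoin).prod
    (Measure.infinitePi fun w => (b w fun u => x u).toMeasure)).map fun p => resample G p.1 p.2 x

open Classical in
/-- The probability that the new state of `w` is `s`, given the updated vertices. -/
def siteWeight (η : V → Bool) (w : V) (s : S) (x : V → S) : ℝ≥0∞ :=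
  if IsUpdated G η w then b w (fun u => x u) s else if x w = s then 1 else 0

lemma measurable_siteWeight (w : V) (s : S) :
    Measurable fun q : (V → S) × (V → Bool) => siteWeight b q.2 w s q.1 := by
  classical
  refine Measurable.ite (measurable_snd (measurableSet_isUpdated G w)) ?_ ?_
  · have h : Measurable fun ω : G.neighborSet w → S => b w ω s := measurable_of_countable _
    exact h.comp (f := fun (q : (V → S) × (V → Bool)) (u : G.neighborSet w) => q.1 u)
      (by fun_prop)
  · exact Measurable.ite (measurableSet_eq_const (f := fun q : (V → S) × (V → Bool) => q.1 w)
      (by fun_prop) s) measurable_const measurable_const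

lemma stepLaw_cylinder (x : V → S) (A : Finset V) (σ : V → S) :
    stepLaw b x {y | ∀ a ∈ A, y a = σ a} =
      ∫⁻ η, ∏ w ∈ A, siteWeight b η w (σ w) x ∂(Measure.infinitePi fun _ : V => fairCoin) := by
  classical
  have hm : Measurable fun p : (V → Bool) × (V → S) => resample G p.1 p.2 x :=
    (measurable_resample G).comp
      (measurable_fst.prodMk (measurable_snd.prodMk measurable_const))
  have hC := measurableSet_cylinder A σ
  rw [stepLaw, Measure.map_apply hm hC, Measure.prod_apply (hm hC)]
  refine lintegral_congr fun η => ?_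
  have hset : Prod.mk η ⁻¹' ((fun p : (V → Bool) × (V → S) => resample G p.1 p.2 x) ⁻¹'
      {y | ∀ a ∈ A, y a = σ a}) = Set.pi A fun w => if IsUpdated G η w then {σ w} else
        if x w = σ w then Set.univ else ∅ := by
    ext a
    simp only [Set.mem_preimage, Set.mem_ofPred_eq, Set.mem_pi, Finset.mem_coe, resample]
    refine forall₂_congr fun w _ => ?_
    by_cases h1 : IsUpdated G η w <;> by_cases h2 : x w = σ w <;> simp [h1, h2]
  rw [hset, Measure.infinitePi_pi]
  · refine Finset.prod_congr rfl fun w _ => ?_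
    by_cases h1 : IsUpdated G η w
    · simp [siteWeight, h1]
    · by_cases h2 : x w = σ w <;> simp [siteWeight, h1, h2]
  · exact fun w _ => MeasurableSet.of_discrete

open Classical in
lemma lintegral_prod_rule {ν : Measure (V → S)} (hν : IsMarkovField b ν) {η : V → Bool}
    (σ : V → S) {A J : Finset V} (hJA : J ⊆ A) (hJ : ∀ w ∈ J, IsUpdated G η w) :
    ∫⁻ x, (∏ w ∈ J, b w (fun u => x u) (σ w)) *
        ∏ w ∈ A \ J, (if x w = σ w then 1 else 0) ∂ν = ν {x | ∀ a ∈ A, x a = σ a} := by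
  induction J using Finset.induction_on with
  | empty =>
    rw [← lintegral_indicator_one (measurableSet_cylinder A σ)]
    refine lintegral_congr fun x => ?_
    rw [Finset.prod_empty, one_mul, Finset.sdiff_empty, Finset.prod_ite_zero, Set.indicator]
    simp
  | insert w J hw ih =>
    rw [← ih ((Finset.subset_insert _ _).trans hJA)
      fun v hv => hJ v (Finset.mem_insert_of_mem hv)]
    have hwA : w ∈ A := hJA (Finset.mem_insert_self _ _)
    have hsd : A \ J = insert w (A \ insert w J) := by
      ext v
      simp only [Finset.mem_sdiff, Finset.mem_insert]
      by_cases hvw : v = w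
      · subst hvw; simp [hwA, hw]
      · simp [hvw]
    let f : (V → S) → ℝ≥0∞ := fun x => (∏ v ∈ J, b v (fun u => x u) (σ v)) *
        ∏ v ∈ A \ insert w J, (if x v = σ v then 1 else 0)
    have key := lintegral_mul_rule b hν (w := w)
      (A := (J.biUnion fun v => G.neighborFinset v) ∪ (A \ insert w J)) ?_ (σ w) (f := f) ?_
    · convert key using 2 with x x
      · funext x
        rw [Finset.prod_insert hw]
        simp only [f]
        ring
      · funext x
        rw [hsd, Finset.prod_insert (by simp)]
        simp only [f]
        ring
    · -- no neighbour of an updated vertex is updated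
      intro hmem
      rw [Finset.mem_union, Finset.mem_biUnion] at hmem
      rcases hmem with ⟨v, hv, hvw⟩ | hmem
      · have h1 := (hJ v (Finset.mem_insert_of_mem hv)).2 w hvw
        have h2 := (hJ w (Finset.mem_insert_self _ _)).1
        rw [h1] at h2
        exact absurd h2 (by simp)
      · simp at hmem
    · intro x y hxy
      simp only [f]
      congr 1
      · refine Finset.prod_congr rfl fun v hv => ?_
        congr 2
        funext u
        refine hxy u (Finset.mem_union_left _ (Finset.mem_biUnion.2 ⟨v, hv, ?_⟩))
        exact (SimpleGraph.mem_neighborFinset _ _ _).2 u.2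
      · refine Finset.prod_congr rfl fun v hv => ?_
        rw [hxy v (Finset.mem_union_right _ hv)]

variable [Nonempty S]

/-- One step of the heat bath dynamics for the local rule `b`, run for a sequence `z` of labellings
simultaneously: at each updated vertex the new states of consecutive members of the sequence are
maximally coupled. -/
def step (θ : V → SiteNoise) (z : ℕ → V → S) (n : ℕ) : V → S :=
  resample G (fun w => (θ w).1)
    (fun w => coupledSeq (fun m => b w fun u => z m u) (θ w).2 n) (z n)

lemma measurable_step :
    Measurable fun q : (V → SiteNoise) × (ℕ → V → S) => step b q.1 q.2 := by
  refine measurable_pi_iff.2 fun n => ?_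
  refine (measurable_resample G).comp (Measurable.prodMk ?_ (Measurable.prodMk ?_ ?_))
  · fun_prop
  · refine measurable_pi_iff.2 fun w => ?_
    refine measurable_coupledSeq (b w)
      (l := fun (q : (V → SiteNoise) × (ℕ → V → S)) m (u : G.neighborSet w) => q.2 m u)
      (r := fun q => (q.1 w).2) ?_ ?_ n
    · fun_prop
    · fun_prop
  · fun_prop

lemma map_step_apply (z : ℕ → V → S) (n : ℕ) :
    (noiseLaw V).map (fun θ => step b θ z n) = stepLaw b (z n) := by
  have hm : Measurable fun p : V → Bool × S =>
      resample G (fun w => (p w).1) (fun w => (p w).2) (z n) := by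
    refine (measurable_resample G).comp (Measurable.prodMk ?_ (Measurable.prodMk ?_ ?_)) <;>
      fun_prop
  let f : V → SiteNoise → Bool × S := fun w =>
    Prod.map id fun r => coupledSeq (fun m => b w fun u => z m u) r n
  have hf (w : V) : Measurable (f w) :=
    measurable_id.prodMap (measurable_coupledSeq_right _ n)
  have h1 (w : V) : (fairCoin.prod uniformSeq).map (f w) =
      fairCoin.prod (b w fun u => z n u).toMeasure := by
    rw [← Measure.map_prod_map _ _ measurable_id (measurable_coupledSeq_right _ n), Measure.map_id,
      map_coupledSeq]
  have h2 : (fun θ => step b θ z n) =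
      (fun p : V → Bool × S => resample G (fun w => (p w).1) (fun w => (p w).2) (z n)) ∘
        fun θ w => f w (θ w) := rfl
  rw [h2, ← Measure.map_map hm (by fun_prop), noiseLaw, Measure.infinitePi_map_pi _ hf]
  simp_rw [h1]
  rw [← map_zip_infinitePi, Measure.map_map hm (by fun_prop)]
  rfl

/-- The law after one step of the dynamics, started from a labelling of law `μ`. -/
def evolve (μ : Measure (V → S)) : Measure (V → S) :=
  ((noiseLaw V).prod μ).map fun q => step b q.1 (fun _ => q.2) 0

lemma measurable_step_line :
    Measurable fun q : (V → SiteNoise) × (V → S) => step b q.1 (fun _ => q.2) 0 := by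
  have h := (measurable_step b).comp
    (f := fun q : (V → SiteNoise) × (V → S) => (q.1, fun _ : ℕ => q.2)) (by fun_prop)
  exact (measurable_pi_apply 0).comp h

lemma evolve_apply (μ : Measure (V → S)) [SFinite μ] {C : Set (V → S)} (hC : MeasurableSet C) :
    evolve b μ C = ∫⁻ x, stepLaw b x C ∂μ := by
  rw [evolve, Measure.map_apply (measurable_step_line b) hC,
    Measure.prod_apply_symm (measurable_step_line b hC)]
  refine lintegral_congr fun x => ?_
  rw [← map_step_apply b (fun _ => x) 0, Measure.map_apply _ hC]
  · rfl
  · exact (measurable_step_line b).comp measurable_prodMk_right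

instance (μ : Measure (V → S)) [IsProbabilityMeasure μ] : IsProbabilityMeasure (evolve b μ) :=
  Measure.isProbabilityMeasure_map (measurable_step_line b).aemeasurable

/-- Every member of the coupled sequence evolves as the heat bath dynamics. -/
lemma map_step (M : Measure (ℕ → V → S)) [SFinite M] (n : ℕ) :
    ((noiseLaw V).prod M).map (fun q => step b q.1 q.2 n) = evolve b (M.map fun z => z n) := by
  have hm : Measurable fun q : (V → SiteNoise) × (ℕ → V → S) => step b q.1 q.2 n :=
    (measurable_pi_apply n).comp (measurable_step b)
  refine Measure.ext fun C hC => ?_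
  have hstep : Measurable fun x => stepLaw b x C := by
    have h (x : V → S) : stepLaw b x C =
        noiseLaw V ((fun θ => (θ, x)) ⁻¹'
          ((fun q : (V → SiteNoise) × (V → S) => step b q.1 (fun _ => q.2) 0) ⁻¹' C)) := by
      rw [← map_step_apply b (fun _ => x) 0, Measure.map_apply _ hC]
      · rfl
      · exact (measurable_step_line b).comp measurable_prodMk_right
    simp_rw [h]
    exact measurable_measure_prodMk_right (measurable_step_line b hC)
  rw [evolve_apply b _ hC, lintegral_map hstep (measurable_pi_apply n),
    Measure.map_apply hm hC, Measure.prod_apply_symm (hm hC)]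
  refine lintegral_congr fun z => ?_
  rw [← map_step_apply b z n, Measure.map_apply _ hC]
  · rfl
  · exact hm.comp measurable_prodMk_right

/-- A Markov random field with conditional distributions `b` is stationary for the heat bath
dynamics. -/
theorem evolve_eq_self {ν : Measure (V → S)} [IsProbabilityMeasure ν]
    (hν : IsMarkovField b ν) : evolve b ν = ν := by
  classical
  refine ext_of_cylinders fun A σ => ?_
  rw [evolve_apply b ν (measurableSet_cylinder A σ)]
  simp_rw [stepLaw_cylinder]
  rw [lintegral_lintegral_swap]
  · have h (η : V → Bool) :
        ∫⁻ x, ∏ w ∈ A, siteWeight b η w (σ w) x ∂ν = ν {x | ∀ a ∈ A, x a = σ a} := by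
      rw [← lintegral_prod_rule b hν σ (J := A.filter fun w => IsUpdated G η w)
        (Finset.filter_subset _ _) fun w hw => (Finset.mem_filter.1 hw).2]
      refine lintegral_congr fun x => ?_
      rw [← Finset.prod_filter_mul_prod_filter_not A fun w => IsUpdated G η w,
        ← Finset.filter_not]
      congr 1
      · exact Finset.prod_congr rfl fun w hw => by
          simp [siteWeight, (Finset.mem_filter.1 hw).2]
      · exact Finset.prod_congr rfl fun w hw => by
          simp [siteWeight, (Finset.mem_filter.1 hw).2]
    simp_rw [h]
    simp
  · exact (Finset.measurable_prod A fun w _ => measurable_siteWeight b w (σ w)).aemeasurable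

end Glauber

/-! ### Contraction and convergence to the stationary law -/

section Contraction

variable {V S : Type*} {G : SimpleGraph V} [G.LocallyFinite]

lemma noiseLaw_isUpdated_and (w : V) {T : Set (ℕ → unitInterval)} (hT : MeasurableSet T) :
    noiseLaw V {θ | IsUpdated G (fun v => (θ v).1) w ∧ (θ w).2 ∈ T} =
      2⁻¹ ^ (G.degree w + 1) * uniformSeq T := by
  classical
  let t : V → Set SiteNoise := fun v => if v = w then {true} ×ˢ T else {false} ×ˢ Set.univ
  have ht (v : V) : MeasurableSet (t v) := by
    by_cases hv : v = w
    · simpa [t, hv] using (measurableSet_singleton true).prod hT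
    · simpa [t, hv] using (measurableSet_singleton false).prod MeasurableSet.univ
  have hw : w ∉ G.neighborFinset w := by simp
  have hset : {θ : V → SiteNoise | IsUpdated G (fun v => (θ v).1) w ∧ (θ w).2 ∈ T} =
      Set.pi (insert w (G.neighborFinset w) : Finset V) t := by
    ext θ
    simp only [Set.mem_ofPred_eq, IsUpdated, Set.mem_pi, Finset.mem_coe, Finset.mem_insert,
      forall_eq_or_imp]
    have h1 : θ w ∈ t w ↔ (θ w).1 = true ∧ (θ w).2 ∈ T := by simp [t, Set.mem_prod]
    have h2 : (∀ u ∈ G.neighborFinset w, θ u ∈ t u) ↔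
        ∀ u ∈ G.neighborFinset w, (θ u).1 = false := by
      refine forall₂_congr fun u hu => ?_
      have : u ≠ w := fun h => hw (h ▸ hu)
      simp [t, this, Set.mem_prod]
    rw [h1, h2]
    tauto
  rw [hset, noiseLaw, Measure.infinitePi_pi _ fun v _ => ht v, Finset.prod_insert hw]
  have h1 : (fairCoin.prod uniformSeq) (t w) = 2⁻¹ * uniformSeq T := by
    simp [t, Measure.prod_prod, fairCoin_singleton]
  have h2 : ∏ u ∈ G.neighborFinset w, (fairCoin.prod uniformSeq) (t u) =
      2⁻¹ ^ G.degree w := by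
    rw [← SimpleGraph.card_neighborFinset_eq_degree, ← Finset.prod_const]
    refine Finset.prod_congr rfl fun u hu => ?_
    have : u ≠ w := fun h => hw (h ▸ hu)
    simp [t, this, Measure.prod_prod, fairCoin_singleton]
  rw [h1, h2, pow_succ]
  ring

lemma noiseLaw_isUpdated (w : V) :
    noiseLaw V {θ | IsUpdated G (fun v => (θ v).1) w} = 2⁻¹ ^ (G.degree w + 1) := by
  simpa using noiseLaw_isUpdated_and (G := G) w MeasurableSet.univ

variable [Fintype S] [Nonempty S] [MeasurableSpace S] [DiscreteMeasurableSpace S]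
variable (b : ∀ w : V, (G.neighborSet w → S) → PMF S)

open Classical in
/-- The influence of a neighbour on the local rule is at most `D`. -/
def HasInfluenceLE (D : ℝ) : Prop :=
  ∀ (w : V) (x y : V → S), tvDist (b w fun u => x u) (b w fun u => y u) ≤
    D * ((G.neighborFinset w).filter fun u => x u ≠ y u).card

/-- The factor by which one step of the dynamics reduces the disagreement of two consecutive
labellings: a vertex keeps its disagreement if it is not updated; if it is updated, then each of
its `d` neighbours creates one with probability at most `D`. -/
def rate (d : ℕ) (D : ℝ) : ℝ≥0∞ :=
  (1 - 2⁻¹ ^ (d + 1)) + 2⁻¹ ^ (d + 1) * (ENNReal.ofReal D * d)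

lemma rate_lt_one {d : ℕ} (hd : 0 < d) {D : ℝ} (hD : D < 1 / (d : ℝ)) : rate d D < 1 := by
  have hd' : (0 : ℝ) < d := by exact_mod_cast hd
  have h1 : ENNReal.ofReal D * d < 1 := by
    rw [← ENNReal.ofReal_natCast, ← ENNReal.ofReal_mul' (by positivity), ENNReal.ofReal_lt_one]
    rwa [lt_div_iff₀ hd'] at hD
  have hc1 : (2⁻¹ : ℝ≥0∞) ^ (d + 1) ≤ 1 := pow_le_one₀ zero_le (by simp)
  have hc0 : (2⁻¹ : ℝ≥0∞) ^ (d + 1) ≠ 0 := pow_ne_zero _ (by simp)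
  have hct : (2⁻¹ : ℝ≥0∞) ^ (d + 1) ≠ ∞ := (hc1.trans_lt ENNReal.one_lt_top).ne
  calc rate d D < (1 - 2⁻¹ ^ (d + 1)) + 2⁻¹ ^ (d + 1) := by
        refine ENNReal.add_lt_add_left (ENNReal.sub_ne_top ENNReal.one_ne_top) ?_
        conv_rhs => rw [← mul_one (2⁻¹ ^ (d + 1) : ℝ≥0∞)]
        exact (ENNReal.mul_lt_mul_iff_right hc0 hct).2 h1
    _ = 1 := tsub_add_cancel_of_le hc1

open Classical in
lemma noiseLaw_step_ne_le {d : ℕ} (hreg : G.IsRegularOfDegree d) {D : ℝ}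
    (hb : HasInfluenceLE b D) (z : ℕ → V → S) (n : ℕ) (w : V) :
    noiseLaw V {θ | step b θ z n w ≠ step b θ z (n + 1) w} ≤
      (1 - 2⁻¹ ^ (d + 1)) * (if z n w ≠ z (n + 1) w then 1 else 0) +
        2⁻¹ ^ (d + 1) * (ENNReal.ofReal D *
          ∑ u ∈ G.neighborFinset w, if z n u ≠ z (n + 1) u then 1 else 0) := by
  set p : ℕ → PMF S := fun m => b w fun u => z m u with hp
  set T : Set (ℕ → unitInterval) := {r | coupledSeq p r n ≠ coupledSeq p r (n + 1)} with hT
  have hTm : MeasurableSet T :=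
    (measurableSet_eq_fun (measurable_coupledSeq_right p n)
      (measurable_coupledSeq_right p (n + 1))).compl
  have hUm : MeasurableSet {θ : V → SiteNoise | IsUpdated G (fun v => (θ v).1) w} := by
    have h : Measurable fun (θ : V → SiteNoise) v => (θ v).1 := by fun_prop
    exact h (measurableSet_isUpdated G w)
  have hsub : {θ : V → SiteNoise | step b θ z n w ≠ step b θ z (n + 1) w} ⊆
      {θ | z n w ≠ z (n + 1) w ∧ ¬ IsUpdated G (fun v => (θ v).1) w} ∪
        {θ | IsUpdated G (fun v => (θ v).1) w ∧ (θ w).2 ∈ T} := by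
    intro θ hθ
    by_cases h : IsUpdated G (fun v => (θ v).1) w
    · refine Or.inr ⟨h, ?_⟩
      simpa [step, resample, h, hT] using hθ
    · refine Or.inl ⟨?_, h⟩
      simpa [step, resample, h] using hθ
  refine (measure_mono hsub).trans ((measure_union_le _ _).trans (add_le_add ?_ ?_))
  · by_cases hz : z n w ≠ z (n + 1) w
    · simp only [hz, ne_eq, not_false_eq_true, true_and, if_true, mul_one]
      have h := prob_compl_eq_one_sub (μ := noiseLaw V) hUm
      rw [noiseLaw_isUpdated, hreg.degree_eq] at h
      exact h.le
    · simp [hz]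
  · rw [noiseLaw_isUpdated_and w hTm, hreg.degree_eq]
    gcongr
    refine (uniformSeq_coupledSeq_ne_le p n).trans ?_
    rw [← Finset.sum_filter, Finset.sum_const, nsmul_eq_mul, mul_one,
      ← ENNReal.ofReal_natCast, ← ENNReal.ofReal_mul' (by positivity)]
    exact ENNReal.ofReal_le_ofReal (hb w _ _)

/-- One step of the dynamics contracts the disagreement of consecutive labellings. -/
lemma prod_step_ne_le {d : ℕ} (hreg : G.IsRegularOfDegree d) {D : ℝ} (hb : HasInfluenceLE b D)
    (M : Measure (ℕ → V → S)) [SFinite M] (n : ℕ) {ε : ℝ≥0∞}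
    (hε : ∀ u, M {z | z n u ≠ z (n + 1) u} ≤ ε) (w : V) :
    ((noiseLaw V).prod M) {q | step b q.1 q.2 n w ≠ step b q.1 q.2 (n + 1) w} ≤
      rate d D * ε := by
  classical
  have hm (n : ℕ) (w : V) : Measurable fun q : (V → SiteNoise) × (ℕ → V → S) =>
      step b q.1 q.2 n w :=
    (measurable_pi_apply w).comp ((measurable_pi_apply n).comp (measurable_step b))
  have hset : MeasurableSet {q : (V → SiteNoise) × (ℕ → V → S) |
      step b q.1 q.2 n w ≠ step b q.1 q.2 (n + 1) w} :=
    (measurableSet_eq_fun (hm n w) (hm (n + 1) w)).compl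
  have hzm (u : V) : MeasurableSet {z : ℕ → V → S | z n u ≠ z (n + 1) u} :=
    (measurableSet_eq_fun (by fun_prop) (by fun_prop)).compl
  have hind (u : V) : ∫⁻ z, (if z n u ≠ z (n + 1) u then 1 else 0) ∂M =
      M {z | z n u ≠ z (n + 1) u} := by
    rw [← lintegral_indicator_one (hzm u)]
    refine lintegral_congr fun z => ?_
    simp [Set.indicator]
  have hindm (u : V) :
      Measurable fun z : ℕ → V → S => if z n u ≠ z (n + 1) u then (1 : ℝ≥0∞) else 0 :=
    Measurable.ite (hzm u) measurable_const measurable_const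
  rw [Measure.prod_apply_symm hset]
  calc ∫⁻ z, noiseLaw V {θ | step b θ z n w ≠ step b θ z (n + 1) w} ∂M
      ≤ ∫⁻ z, (1 - 2⁻¹ ^ (d + 1)) * (if z n w ≠ z (n + 1) w then 1 else 0) +
        2⁻¹ ^ (d + 1) * (ENNReal.ofReal D *
          ∑ u ∈ G.neighborFinset w, if z n u ≠ z (n + 1) u then 1 else 0) ∂M :=
        lintegral_mono fun z => noiseLaw_step_ne_le b hreg hb z n w
    _ = (1 - 2⁻¹ ^ (d + 1)) * M {z | z n w ≠ z (n + 1) w} + 2⁻¹ ^ (d + 1) *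
          (ENNReal.ofReal D * ∑ u ∈ G.neighborFinset w, M {z | z n u ≠ z (n + 1) u}) := by
        rw [lintegral_add_left ((hindm w).const_mul _), lintegral_const_mul _ (hindm w),
          lintegral_const_mul _ ((Finset.measurable_sum _ fun u _ => hindm u).const_mul _),
          lintegral_const_mul _ (Finset.measurable_sum _ fun u _ => hindm u),
          lintegral_finsetSum _ fun u _ => hindm u]
        simp_rw [hind]
    _ ≤ (1 - 2⁻¹ ^ (d + 1)) * ε + 2⁻¹ ^ (d + 1) *
          (ENNReal.ofReal D * ∑ _u ∈ G.neighborFinset w, ε) := by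
        gcongr with u _
        · exact hε w
        · exact hε u
    _ = rate d D * ε := by
        rw [Finset.sum_const, SimpleGraph.card_neighborFinset_eq_degree, hreg.degree_eq,
          nsmul_eq_mul, rate]
        ring

/-- The law after one step of a random sequence of labellings that evolve together. -/
def evolveSeq (M : Measure (ℕ → V → S)) : Measure (ℕ → V → S) :=
  ((noiseLaw V).prod M).map fun q => step b q.1 q.2

instance (M : Measure (ℕ → V → S)) [IsProbabilityMeasure M] :
    IsProbabilityMeasure (evolveSeq b M) :=
  Measure.isProbabilityMeasure_map (measurable_step b).aemeasurable

lemma map_evolveSeq (M : Measure (ℕ → V → S)) [SFinite M] (n : ℕ) :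
    (evolveSeq b M).map (fun z => z n) = evolve b (M.map fun z => z n) := by
  rw [evolveSeq, Measure.map_map (by fun_prop) (measurable_step b), ← map_step]
  rfl

lemma evolveSeq_ne_le {d : ℕ} (hreg : G.IsRegularOfDegree d) {D : ℝ} (hb : HasInfluenceLE b D)
    (M : Measure (ℕ → V → S)) [SFinite M] (n : ℕ) {ε : ℝ≥0∞}
    (hε : ∀ u, M {z | z n u ≠ z (n + 1) u} ≤ ε) (w : V) :
    evolveSeq b M {z | z n w ≠ z (n + 1) w} ≤ rate d D * ε := by
  have hzm : MeasurableSet {z : ℕ → V → S | z n w ≠ z (n + 1) w} :=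
    (measurableSet_eq_fun (by fun_prop) (by fun_prop)).compl
  rw [evolveSeq, Measure.map_apply (measurable_step b) hzm]
  exact prod_step_ne_le b hreg hb M n hε w

/-- The dynamics started from a fixed labelling converges to every stationary law. -/
theorem tendsto_evolve_iterate {d : ℕ} (hreg : G.IsRegularOfDegree d) {D : ℝ}
    (hb : HasInfluenceLE b D) (hrate : rate d D < 1) {ν : Measure (V → S)}
    [IsProbabilityMeasure ν] (hν : evolve b ν = ν) (x₀ : V → S) (A : Finset V) (σ : V → S) :
    Filter.Tendsto (fun k => (evolve b)^[k] (Measure.dirac x₀) {x | ∀ a ∈ A, x a = σ a})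
      Filter.atTop (nhds (ν {x | ∀ a ∈ A, x a = σ a})) := by
  set C : Set (V → S) := {x | ∀ a ∈ A, x a = σ a} with hC
  have hCm : MeasurableSet C := measurableSet_cylinder A σ
  -- the labelling `x₀` and a labelling of law `ν`
  have hgm : Measurable fun (y : V → S) (m : ℕ) => if m = 0 then x₀ else y :=
    measurable_pi_iff.2 fun m => by
      by_cases hm : m = 0
      · simp only [hm, if_true]; exact measurable_const
      · simp only [hm, if_false]; exact measurable_id
  set M₀ : Measure (ℕ → V → S) := ν.map fun y m => if m = 0 then x₀ else y with hM₀
  have : IsProbabilityMeasure M₀ := Measure.isProbabilityMeasure_map hgm.aemeasurable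
  have h0 : M₀.map (fun z => z 0) = Measure.dirac x₀ := by
    rw [hM₀, Measure.map_map (by fun_prop) hgm]
    have : (fun z : ℕ → V → S => z 0) ∘ (fun (y : V → S) (m : ℕ) => if m = 0 then x₀ else y) =
      fun _ => x₀ := by funext y; simp
    rw [this, Measure.map_const, measure_univ, one_smul]
  have h1 : M₀.map (fun z => z 1) = ν := by
    rw [hM₀, Measure.map_map (by fun_prop) hgm]
    have : (fun z : ℕ → V → S => z 1) ∘ (fun (y : V → S) (m : ℕ) => if m = 0 then x₀ else y) =
      id := by funext y; simp
    rw [this, Measure.map_id]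
  have key (k : ℕ) : IsProbabilityMeasure ((evolveSeq b)^[k] M₀) ∧
      ((evolveSeq b)^[k] M₀).map (fun z => z 0) = (evolve b)^[k] (Measure.dirac x₀) ∧
      ((evolveSeq b)^[k] M₀).map (fun z => z 1) = ν ∧
      ∀ w, ((evolveSeq b)^[k] M₀) {z | z 0 w ≠ z (0 + 1) w} ≤ rate d D ^ k := by
    induction k with
    | zero => exact ⟨this, h0, h1, fun w => by simpa using prob_le_one⟩
    | succ k ih =>
      obtain ⟨i1, i2, i3, i4⟩ := ih
      simp only [Function.iterate_succ_apply']
      refine ⟨inferInstance, ?_, ?_, fun w => ?_⟩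
      · rw [map_evolveSeq, i2]
      · rw [map_evolveSeq, i3, hν]
      · rw [pow_succ']
        exact evolveSeq_ne_le b hreg hb _ 0 i4 w
  have hlim : Filter.Tendsto (fun k => (A.card : ℝ≥0∞) * rate d D ^ k) Filter.atTop (nhds 0) := by
    have := ENNReal.Tendsto.const_mul (a := (A.card : ℝ≥0∞))
      (ENNReal.tendsto_pow_atTop_nhds_zero_of_lt_one hrate) (Or.inr (ENNReal.natCast_ne_top _))
    simpa using this
  have hdis (k : ℕ) : ((evolveSeq b)^[k] M₀) {z | ∃ a ∈ A, z 0 a ≠ z (0 + 1) a} ≤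
      A.card * rate d D ^ k := by
    have hset : {z : ℕ → V → S | ∃ a ∈ A, z 0 a ≠ z (0 + 1) a} =
        ⋃ a ∈ A, {z | z 0 a ≠ z (0 + 1) a} := by
      ext z; simp
    rw [hset]
    refine (measure_biUnion_finset_le _ _).trans ?_
    rw [← nsmul_eq_mul, ← Finset.sum_const]
    gcongr with a _
    exact (key k).2.2.2 a
  have hmap (k n : ℕ) : (((evolveSeq b)^[k] M₀).map fun z => z n) C =
      ((evolveSeq b)^[k] M₀) {z | z n ∈ C} := Measure.map_apply (by fun_prop) hCm
  have hup (k : ℕ) : (evolve b)^[k] (Measure.dirac x₀) C ≤ ν C + A.card * rate d D ^ k := by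
    rw [← (key k).2.1]
    conv_rhs => rw [← (key k).2.2.1]
    rw [hmap, hmap]
    refine (measure_mono ?_).trans ((measure_union_le _ _).trans
      (add_le_add_right (hdis k) _))
    intro z hz
    by_cases h : ∃ a ∈ A, z 0 a ≠ z (0 + 1) a
    · exact Or.inr h
    · push Not at h
      exact Or.inl fun a ha => (h a ha).symm.trans (hz a ha)
  have hlow (k : ℕ) : ν C - A.card * rate d D ^ k ≤ (evolve b)^[k] (Measure.dirac x₀) C := by
    rw [tsub_le_iff_right, ← (key k).2.1]
    conv_lhs => rw [← (key k).2.2.1]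
    rw [hmap, hmap]
    refine (measure_mono ?_).trans ((measure_union_le _ _).trans
      (add_le_add_right (hdis k) _))
    intro z hz
    by_cases h : ∃ a ∈ A, z 0 a ≠ z (0 + 1) a
    · exact Or.inr h
    · push Not at h
      exact Or.inl fun a ha => (h a ha).trans (hz a ha)
  refine tendsto_of_tendsto_of_tendsto_of_le_of_le ?_ ?_ hlow hup
  · have := ENNReal.Tendsto.sub (tendsto_const_nhds (x := ν C)) hlim
      (Or.inl (measure_ne_top ν C))
    simpa using this
  · simpa using (tendsto_const_nhds (x := ν C)).add hlim

end Contraction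

/-! ### Dynamics from the infinitely remote past -/

section EventualValue

variable {S : Type*}

open Classical in
/-- The eventual value of a sequence, and `s₀` if the sequence is not eventually constant. -/
def eventualValue (s₀ : S) (f : ℕ → S) : S :=
  if h : ∃ s, ∀ᶠ n in Filter.atTop, f n = s then h.choose else s₀

lemma eventually_eq_eventualValue (s₀ : S) {f : ℕ → S}
    (h : ∀ᶠ n in Filter.atTop, f n = f (n + 1)) :
    ∀ᶠ n in Filter.atTop, f n = eventualValue s₀ f := by
  have h' : ∃ s, ∀ᶠ n in Filter.atTop, f n = s := by
    obtain ⟨N, hN⟩ := Filter.eventually_atTop.1 h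
    refine ⟨f N, Filter.eventually_atTop.2 ⟨N, fun n hn => ?_⟩⟩
    induction n, hn using Nat.le_induction with
    | base => rfl
    | succ n hn ih => rw [← hN n hn, ih]
  rw [eventualValue, dif_pos h']
  exact h'.choose_spec

lemma measurable_eventualValue [Countable S] [MeasurableSpace S] [DiscreteMeasurableSpace S]
    (s₀ : S) : Measurable (eventualValue s₀) := by
  have hE (s : S) : MeasurableSet {f : ℕ → S | ∀ᶠ n in Filter.atTop, f n = s} := by
    simp only [Filter.eventually_atTop, Set.ofPred_exists, Set.ofPred_forall]
    exact MeasurableSet.iUnion fun N => MeasurableSet.iInter fun n =>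
      MeasurableSet.iInter fun _ =>
        measurableSet_eq_const (f := fun f : ℕ → S => f n) (measurable_pi_apply n) s
  have hN : MeasurableSet {f : ℕ → S | ∃ s, ∀ᶠ n in Filter.atTop, f n = s} := by
    simp only [Set.ofPred_exists]
    exact MeasurableSet.iUnion hE
  refine measurable_to_countable' fun s => ?_
  have hset : eventualValue s₀ ⁻¹' {s} = {f | ∀ᶠ n in Filter.atTop, f n = s} ∪
      ({f | ∃ s, ∀ᶠ n in Filter.atTop, f n = s}ᶜ ∩ {_f | s₀ = s}) := by
    ext f
    simp only [Set.mem_preimage, Set.mem_singleton_iff, Set.mem_union, Set.mem_ofPred_eq,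
      Set.mem_inter_iff, Set.mem_compl_iff]
    by_cases h : ∃ s, ∀ᶠ n in Filter.atTop, f n = s
    · rw [eventualValue, dif_pos h]
      constructor
      · intro hs
        exact Or.inl (hs ▸ h.choose_spec)
      · rintro (hs | hs)
        · obtain ⟨n, h1, h2⟩ := (h.choose_spec.and hs).exists
          exact h1.symm.trans h2
        · exact absurd h hs.1
    · rw [eventualValue, dif_neg h]
      constructor
      · exact fun hs => Or.inr ⟨h, hs⟩
      · rintro (hs | hs)
        · exact absurd ⟨s, hs⟩ h
        · exact hs.2
  rw [hset]
  exact (hE s).union (hN.compl.inter (MeasurableSet.const _))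

end EventualValue

section Past

variable {V S : Type*} {G : SimpleGraph V} [G.LocallyFinite] [Fintype S] [Nonempty S]
  [MeasurableSpace S] [DiscreteMeasurableSpace S]
variable (b : ∀ w : V, (G.neighborSet w → S) → PMF S)

lemma step_congr (θ : V → SiteNoise) {z z' : ℕ → V → S} {n : ℕ} (h : ∀ m ≤ n, z m = z' m) :
    step b θ z n = step b θ z' n := by
  simp only [step]
  rw [h n le_rfl]
  congr 1
  funext w
  exact coupledSeq_congr (fun m hm => by rw [h m hm]) fun _ _ => rfl

lemma isUpdated_map (φ : G ≃g G) (η : V → Bool) (w : V) :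
    IsUpdated G (fun v => η (φ v)) w ↔ IsUpdated G η (φ w) := by
  simp only [IsUpdated, SimpleGraph.mem_neighborFinset]
  refine and_congr_right fun _ => ⟨fun h u hu => ?_, fun h u hu => ?_⟩
  · have h1 := h (φ.symm u) (by rwa [← φ.map_adj_iff, RelIso.apply_symm_apply])
    rwa [RelIso.apply_symm_apply] at h1
  · exact h (φ u) (φ.map_adj_iff.2 hu)

/-- The local rules at different vertices correspond to each other under automorphisms. -/
def IsEquivariantRule : Prop :=
  ∀ (φ : G ≃g G) (w : V) (x : V → S), b (φ w) (fun u => x u) = b w fun u => x (φ u)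

lemma step_map {b : ∀ w : V, (G.neighborSet w → S) → PMF S} (hb : IsEquivariantRule b)
    (φ : G ≃g G) (θ : V → SiteNoise) (z : ℕ → V → S) (n : ℕ) (w : V) :
    step b (fun v => θ (φ v)) (fun m v => z m (φ v)) n w = step b θ z n (φ w) := by
  have h (m : ℕ) := hb φ w (z m)
  by_cases hw : IsUpdated G (fun v => (θ v).1) (φ w)
  · have hw' := (isUpdated_map φ (fun v => (θ v).1) w).2 hw
    simp only [step, resample, hw, hw', if_true, h]
  · have hw' := mt (isUpdated_map φ (fun v => (θ v).1) w).1 hw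
    simp only [step, resample, hw, hw', if_false]

/-- The `n`-th labelling starts from `x₀` at time `-n` and follows the coupled dynamics, with the
randomness `h i` in the step to time `-(j + i)`; `lines b x₀ k j h n` is its state at time `-j`
if all labellings are started at time `-(j + k)` or later. -/
def lines (x₀ : V → S) : ℕ → ℕ → (ℕ → V → SiteNoise) → ℕ → V → S
  | 0, _, _, _ => x₀
  | k + 1, j, h, n =>
      if n ≤ j then x₀ else step b (h 0) (lines x₀ k (j + 1) fun i => h (i + 1)) n

lemma lines_succ_of_le (x₀ : V → S) {k j n : ℕ} (h : ℕ → V → SiteNoise) (hn : n ≤ j + k) :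
    lines b x₀ (k + 1) j h n = lines b x₀ k j h n := by
  induction k generalizing j n h with
  | zero => simp only [lines]; exact if_pos hn
  | succ k ih =>
    rw [lines, lines]
    by_cases hnj : n ≤ j
    · rw [if_pos hnj, if_pos hnj]
    · rw [if_neg hnj, if_neg hnj]
      exact step_congr b _ fun m hm => ih _ (by lia)

lemma lines_map {b : ∀ w : V, (G.neighborSet w → S) → PMF S} (hb : IsEquivariantRule b)
    (φ : G ≃g G) (s₀ : S) (k j : ℕ) (h : ℕ → V → SiteNoise) (n : ℕ) (w : V) :
    lines b (fun _ => s₀) k j (fun i v => h i (φ v)) n w =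
      lines b (fun _ => s₀) k j h n (φ w) := by
  induction k generalizing j n h w with
  | zero => rfl
  | succ k ih =>
    rw [lines, lines]
    by_cases hnj : n ≤ j
    · rw [if_pos hnj, if_pos hnj]
    · rw [if_neg hnj, if_neg hnj, ← step_map hb φ]
      congr 2
      funext m v
      exact ih _ _ _ _

lemma measurable_lines (x₀ : V → S) (k j : ℕ) : Measurable (lines b x₀ k j) := by
  induction k generalizing j with
  | zero => exact measurable_const
  | succ k ih =>
    refine measurable_pi_iff.2 fun n => ?_
    simp only [lines]
    by_cases hnj : n ≤ j
    · simp only [if_pos hnj]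
      exact measurable_const
    · simp only [if_neg hnj]
      have h1 : Measurable fun h : ℕ → V → SiteNoise =>
          (h 0, lines b x₀ k (j + 1) fun i => h (i + 1)) :=
        (measurable_pi_apply 0).prodMk ((ih (j + 1)).comp (by fun_prop))
      have h2 := (measurable_step b).comp h1
      exact (measurable_pi_apply n).comp h2

/-- The law of the randomness of all steps. -/
def pastLaw (V : Type*) : Measure (ℕ → V → SiteNoise) :=
  Measure.infinitePi fun _ : ℕ => noiseLaw V

instance (V : Type*) : IsProbabilityMeasure (pastLaw V) := by
  unfold pastLaw; infer_instance

lemma map_pastLaw {Y : Type*} [MeasurableSpace Y] {f : (V → SiteNoise) × (ℕ → V → S) → Y}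
    (hf : Measurable f) (x₀ : V → S) (k j : ℕ) :
    (pastLaw V).map (fun h => f (h 0, lines b x₀ k j fun i => h (i + 1))) =
      ((noiseLaw V).prod ((pastLaw V).map (lines b x₀ k j))).map f := by
  have hm : Measurable fun h : ℕ → V → SiteNoise =>
      f (h 0, lines b x₀ k j fun i => h (i + 1)) :=
    hf.comp ((measurable_pi_apply 0).prodMk ((measurable_lines b x₀ k j).comp (by fun_prop)))
  conv_lhs => rw [pastLaw, ← map_cons_infinitePi]
  rw [Measure.map_map hm measurable_cons, ← pastLaw]
  conv_rhs => rw [← Measure.map_id (μ := noiseLaw V)]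
  rw [Measure.map_prod_map _ _ measurable_id (measurable_lines b x₀ k j),
    Measure.map_map hf (measurable_id.prodMap (measurable_lines b x₀ k j))]
  rfl

lemma map_lines (x₀ : V → S) {k j n : ℕ} (hn : j + k ≤ n) :
    (pastLaw V).map (fun h => lines b x₀ k j h n) = (evolve b)^[k] (Measure.dirac x₀) := by
  induction k generalizing j with
  | zero =>
    simp only [lines, Function.iterate_zero, id]
    rw [Measure.map_const, measure_univ, one_smul]
  | succ k ih =>
    have hnj : ¬ n ≤ j := by lia
    simp only [lines, if_neg hnj]
    have hm : Measurable fun q : (V → SiteNoise) × (ℕ → V → S) => step b q.1 q.2 n :=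
      (measurable_pi_apply n).comp (measurable_step b)
    rw [map_pastLaw b hm x₀ k (j + 1), map_step, Function.iterate_succ_apply',
      ← ih (j := j + 1) (by lia), Measure.map_map (by fun_prop) (measurable_lines b x₀ k (j + 1))]
    rfl

lemma pastLaw_lines_ne_le {d : ℕ} (hreg : G.IsRegularOfDegree d) {D : ℝ}
    (hb : HasInfluenceLE b D) (x₀ : V → S) (k j : ℕ) (w : V) :
    pastLaw V {h | lines b x₀ (k + 1) j h (j + k) w ≠ lines b x₀ (k + 1) j h (j + k + 1) w} ≤
      rate d D ^ k := by
  induction k generalizing j w with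
  | zero => simpa using prob_le_one
  | succ k ih =>
    set n := j + (k + 1) with hn
    have h1 : ¬ n ≤ j := by lia
    have h2 : ¬ n + 1 ≤ j := by lia
    have hm (m : ℕ) : Measurable fun q : (V → SiteNoise) × (ℕ → V → S) => step b q.1 q.2 m w :=
      (measurable_pi_apply w).comp ((measurable_pi_apply m).comp (measurable_step b))
    have hset : MeasurableSet {q : (V → SiteNoise) × (ℕ → V → S) |
        step b q.1 q.2 n w ≠ step b q.1 q.2 (n + 1) w} :=
      (measurableSet_eq_fun (hm n) (hm (n + 1))).compl
    have hmap := map_pastLaw (V := V) b (f := id) measurable_id x₀ (k + 1) (j + 1)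
    simp only [Measure.map_id, id] at hmap
    have hmeas : Measurable fun h : ℕ → V → SiteNoise =>
        (h 0, lines b x₀ (k + 1) (j + 1) fun i => h (i + 1)) :=
      (measurable_pi_apply 0).prodMk ((measurable_lines b x₀ (k + 1) (j + 1)).comp (by fun_prop))
    have hle := prod_step_ne_le b hreg hb ((pastLaw V).map (lines b x₀ (k + 1) (j + 1))) n
      (ε := rate d D ^ k) (fun u => ?_) w
    · rw [← hmap, Measure.map_apply hmeas hset] at hle
      rw [pow_succ']
      refine le_trans (le_of_eq ?_) hle
      congr 1
      ext h
      simp only [Set.mem_ofPred_eq, Set.mem_preimage, lines, if_neg h1, if_neg h2]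
    · have hzm : MeasurableSet {z : ℕ → V → S | z n u ≠ z (n + 1) u} :=
        (measurableSet_eq_fun (by fun_prop) (by fun_prop)).compl
      rw [Measure.map_apply (measurable_lines b x₀ (k + 1) (j + 1)) hzm]
      have h3 := ih (j + 1) u
      have h4 : j + 1 + k = n := by lia
      rwa [h4] at h3

/-- The labelling at time `0` of the dynamics started in the infinitely remote past from the
constant labelling `s₀`. -/
def fromPast (s₀ : S) (h : ℕ → V → SiteNoise) (w : V) : S :=
  eventualValue s₀ fun n => lines b (fun _ => s₀) n 0 h n w

lemma measurable_fromPast (s₀ : S) : Measurable (fromPast b s₀) := by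
  refine measurable_pi_iff.2 fun w => (measurable_eventualValue s₀).comp ?_
  refine measurable_pi_iff.2 fun n => ?_
  exact (measurable_pi_apply w).comp
    ((measurable_pi_apply n).comp (measurable_lines b (fun _ => s₀) n 0))

lemma fromPast_map {b : ∀ w : V, (G.neighborSet w → S) → PMF S} (hb : IsEquivariantRule b)
    (φ : G ≃g G) (s₀ : S) (h : ℕ → V → SiteNoise) (w : V) :
    fromPast b s₀ (fun i v => h i (φ v)) w = fromPast b s₀ h (φ w) := by
  simp only [fromPast, lines_map hb φ]

lemma ae_eventually_eq_fromPast {d : ℕ} (hreg : G.IsRegularOfDegree d) {D : ℝ}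
    (hb : HasInfluenceLE b D) (hrate : rate d D < 1) (s₀ : S) (w : V) :
    ∀ᵐ h ∂pastLaw V, ∀ᶠ n in Filter.atTop,
      lines b (fun _ => s₀) n 0 h n w = fromPast b s₀ h w := by
  have hsum : ∑' n, pastLaw V {h | lines b (fun _ => s₀) n 0 h n w ≠
      lines b (fun _ => s₀) (n + 1) 0 h (n + 1) w} ≠ ∞ := by
    refine ne_top_of_le_ne_top ?_ (ENNReal.tsum_le_tsum (g := fun n => rate d D ^ n) fun n => ?_)
    · rw [ENNReal.tsum_geometric]
      exact ENNReal.inv_ne_top.2 (tsub_pos_of_lt hrate).ne'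
    · have h1 := pastLaw_lines_ne_le b hreg hb (fun _ => s₀) n 0 w
      simp only [zero_add] at h1
      -- the `n`-th labelling is not affected by the earlier start of the `(n + 1)`-st
      simp_rw [lines_succ_of_le b (fun _ => s₀) (j := 0) (k := n) (n := n) _ (by lia)] at h1
      exact h1
  filter_upwards [ae_eventually_notMem hsum] with h hh
  refine eventually_eq_eventualValue s₀ (hh.mono fun n hn => ?_)
  simpa using hn

/-- The labelling obtained from the infinitely remote past has the stationary law. -/
theorem map_fromPast {d : ℕ} (hreg : G.IsRegularOfDegree d) {D : ℝ}
    (hb : HasInfluenceLE b D) (hrate : rate d D < 1) {ν : Measure (V → S)}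
    [IsProbabilityMeasure ν] (hν : evolve b ν = ν) (s₀ : S) :
    (pastLaw V).map (fromPast b s₀) = ν := by
  refine ext_of_cylinders fun A σ => ?_
  have hCm : MeasurableSet {x : V → S | ∀ a ∈ A, x a = σ a} := measurableSet_cylinder A σ
  have hXm (n : ℕ) : Measurable fun h : ℕ → V → SiteNoise => lines b (fun _ => s₀) n 0 h n :=
    (measurable_pi_apply n).comp (measurable_lines b (fun _ => s₀) n 0)
  have hae : ∀ᵐ h ∂pastLaw V, ∀ a ∈ A, ∀ᶠ n in Filter.atTop,
      lines b (fun _ => s₀) n 0 h n a = fromPast b s₀ h a :=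
    (ae_ball_iff A.countable_toSet).2 fun a _ => ae_eventually_eq_fromPast b hreg hb hrate s₀ a
  have h1 : Filter.Tendsto (fun n => pastLaw V
        ((fun h => lines b (fun _ => s₀) n 0 h n) ⁻¹' {x | ∀ a ∈ A, x a = σ a})) Filter.atTop
      (nhds (pastLaw V (fromPast b s₀ ⁻¹' {x | ∀ a ∈ A, x a = σ a}))) := by
    refine tendsto_measure_of_ae_tendsto_indicator Filter.atTop (measurable_fromPast b s₀ hCm)
      (fun n => hXm n hCm) MeasurableSet.univ (measure_ne_top _ _)
      (Filter.Eventually.of_forall fun _ => Set.subset_univ _) ?_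
    filter_upwards [hae] with h hh
    filter_upwards [(Filter.eventually_all_finset A).2 hh] with n hn
    refine forall₂_congr fun a ha => ?_
    rw [← hn a ha]
  have h2 := tendsto_evolve_iterate b hreg hb hrate hν (fun _ => s₀) A σ
  rw [Measure.map_apply (measurable_fromPast b s₀) hCm]
  refine tendsto_nhds_unique h1 (h2.congr fun n => ?_)
  rw [← map_lines b (fun _ => s₀) (j := 0) (n := n) (by lia), Measure.map_apply (hXm n) hCm]

end Past

section Factor

variable {V : Type*}

lemma exists_splitLabel : ∃ m : unitInterval → ℕ → SiteNoise, Measurable m ∧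
    (volume : Measure unitInterval).map m =
      Measure.infinitePi fun _ : ℕ => fairCoin.prod uniformSeq :=
  Measure.exists_measurable_map_eq _

/-- A measurable equivariant function of the uniform labels is a factor. No automorphism that
carries `o` to a given vertex is needed: the rule at `o` is the value of the function at `o`. -/
lemma IsFactor.of_equivariant {G : SimpleGraph V} {M N : Type*} [MeasurableSpace M]
    [MeasurableSpace N] (o : V) {μ : Measure (V → M)} {F : (V → M) → V → N} (hF : Measurable F)
    (heq : ∀ (φ : G ≃g G) (x : V → M) (w : V), F (fun u => x (φ u)) w = F x (φ w)) :
    IsFactor G o (μ.map F) μ := by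
  refine ⟨fun x => F x o, (measurable_pi_apply o).comp hF, fun φ hφ x => ?_, F,
    fun φ x => (heq φ x o).symm, rfl⟩
  exact (heq φ x o).trans (by rw [hφ])

lemma map_splitLabel {m : unitInterval → ℕ → SiteNoise} (hm : Measurable m)
    (hmap : (volume : Measure unitInterval).map m =
      Measure.infinitePi fun _ : ℕ => fairCoin.prod uniformSeq) :
    (uniformLabels V).map (fun x i v => m (x v) i) = pastLaw V := by
  have h1 : (fun (x : V → unitInterval) i v => m (x v) i) =
      (fun (y : V → ℕ → SiteNoise) i v => y v i) ∘ fun x v => m (x v) := rfl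
  rw [h1, ← Measure.map_map (by fun_prop) (by fun_prop), uniformLabels,
    Measure.infinitePi_map_pi _ fun _ => hm]
  simp_rw [hmap]
  rw [map_swap_infinitePi]
  rfl

end Factor

end TreeProcess

end

theorem theorem3p2 {V : Type*} (G : SimpleGraph V) [G.LocallyFinite] (hG : G.IsTree)
    (d : ℕ) (hd : 2 ≤ d) (hreg : G.IsRegularOfDegree d) (o : V)
    {S : Type*} [Fintype S] [MeasurableSpace S] [DiscreteMeasurableSpace S]
    (π : PMF S) (Q : S → PMF S) (hrev : TreeProcess.IsReversible π Q)
    (v : V) (B : (G.neighborSet v → S) → PMF S)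
    (hB : TreeProcess.IsConditionalLaw G (TreeProcess.branchingMarkov hG o π Q) v B)
    (hD : TreeProcess.dobrushinCoeff B < 1 / (d : ℝ)) :
    TreeProcess.branchingMarkov hG o π Q ∈ TreeProcess.factorOfIID G S o := by
  classical
  open TreeProcess in
  obtain ⟨s₀, -⟩ := π.support_nonempty
  have : Nonempty S := ⟨s₀⟩
  have hN (w : V) : Nonempty (G.neighborSet v ≃ G.neighborSet w) := by
    rw [← Fintype.card_eq, SimpleGraph.card_neighborSet_eq_degree,
      SimpleGraph.card_neighborSet_eq_degree, hreg.degree_eq, hreg.degree_eq]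
  set b : ∀ w : V, (G.neighborSet w → S) → PMF S := fun w => averagedRule B w
  have hequi : IsEquivariantRule b := averagedRule_map B
  have hmarkov : IsMarkovField b (branchingMarkov hG o π Q) := fun w A σ hA hw =>
    branchingMarkov_markov hG hrev o (averagedRule_isBayes (hB.isBayes hG hrev) w) hA hw σ
  have hinf : HasInfluenceLE b (dobrushinCoeff B) := by
    intro w x y
    refine (tvDist_averagedRule_le B w (Finset.univ.filter fun u : G.neighborSet w =>
      x u ≠ y u) _ _ fun u hu => by simpa using hu).trans ?_
    refine mul_le_mul_of_nonneg_left ?_ (dobrushinCoeff_nonneg B)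
    rw [Nat.cast_le, ← Finset.card_map (Function.Embedding.subtype _)]
    refine Finset.card_le_card fun u hu => ?_
    simp only [Finset.mem_map, Finset.mem_filter, Finset.mem_univ, true_and] at hu
    obtain ⟨u', hu', rfl⟩ := hu
    exact Finset.mem_filter.2 ⟨(SimpleGraph.mem_neighborFinset _ _ _).2 u'.2, hu'⟩
  have hstat := evolve_eq_self b hmarkov
  have hrate := rate_lt_one (by lia : 0 < d) hD
  obtain ⟨m, hm, hmap⟩ := exists_splitLabel
  have hmm : Measurable fun (x : V → unitInterval) i u => m (x u) i := by fun_prop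
  have hlaw : (uniformLabels V).map (fun x => fromPast b s₀ fun i u => m (x u) i) =
      branchingMarkov hG o π Q := by
    rw [← map_fromPast b hreg hinf hrate hstat s₀, ← map_splitLabel hm hmap,
      Measure.map_map (measurable_fromPast b s₀) hmm]
    rfl
  refine ⟨branchingMarkov_mem_invariantProcesses hG hrev o, ?_⟩
  rw [← hlaw]
  exact IsFactor.of_equivariant o ((measurable_fromPast b s₀).comp hmm) fun φ x w =>
    fromPast_map hequi φ s₀ (fun i u => m (x u) i) w
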